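/- **Notation.** For $y>0$ let $\vartheta_j(x)=\vartheta_j(x;iy)$, where for $\operatorname{Im}w>0$ $$\vartheta_1(x;w)=-\sum_{n\in\mathbb Z}e^{\pi iw(n+\frac12)^2+2\pi i(n+\frac12)(x+\frac12)},\qquad \vartheta_2(x;w)=\sum_{n\in\mathbb Z}e^{\pi iw(n+\frac12)^2+2\pi i(n+\frac12)x},$$ $$\vartheta_3(x;w)=\sum_{n\in\mathbb Z}e^{\pi iwn^2+2\pi inx},\qquad \vartheta_4(x;w)=\sum_{n\in\mathbb Z}e^{\pi iwn^2+2\pi in(x+\frac12)}.$$ Let $y>0$, $r\in\mathbb R\setminus\frac12\mathbb Z$, $v\in\mathbb R\setminus y\mathbb Z$, and put $a=-\frac12iv+r$, $b=\frac12iv+r$, $$\alpha_2=\sqrt{\vartheta_3(2r)\vartheta_3(0)},\quad \beta=\frac{\vartheta_3(iv)}{\vartheta_3(0)},\quad s_2=\vartheta_3(2r)\vartheta_1(iv),\quad u_2=\vartheta_1(a)\vartheta_3(a)\vartheta_1(b)\vartheta_3(b),$$ $$\Delta_j=\frac{\vartheta_j'(a)}{\vartheta_j(a)}-\frac{\vartheta_j'(b)}{\vartheta_j(b)},\qquad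 R_j=\frac{\vartheta_j(a)}{\vartheta_j(b)}\qquad(j=1,3).$$ For $C,\Gamma,t\in\mathbb R$, $n\in\mathbb Z$, $z\in\mathbb C$ let $\mu_n=ivn+\frac{z}{\Delta_3-\Delta_1}$, $E_s=\exp\bigl(\frac{s\Delta_3}{\Delta_3-\Delta_1}z+\frac C2tz\bigr)$, and $$F_n=\alpha_2E_n\,\vartheta_2(\mu_n-\tfrac12iv+it),\qquad f_n=\vartheta_3(a)R_3^nE_{n+\frac12}e^{-\frac{\Gamma}{2}it}\vartheta_2(\mu_n+r+it),$$ $$g_n=\vartheta_1(b)R_1^{-n}E_{n+\frac12}e^{\frac{\Gamma}{2}it}\vartheta_4(\mu_n-r+it),\qquad G_n=\alpha_2\frac{\vartheta_1(iv)}{\vartheta_3(0)}R_1^{-n}R_3^nE_n\,\vartheta_4(\mu_n-\tfrac12iv+it),$$ $$H_n=\frac{u_2}{\alpha_2s_2}R_1^{-n}R_3^{-n}E_ne^{\Gamma it}\vartheta_4(\mu_n-\tfrac12iv-2r+it),\qquad \widetilde G_n=-i\alpha_2\frac{\vartheta_1(iv)}{\vartheta_3(0)}E_n\,\vartheta_4(\mu_n-\tfrac12iv+it).$$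 For a function $h$ of $z$ write $h^*(z)=\overline{h(\bar z)}$ (the complex conjugate of $h(z)$ when $z$ is real). **Theorem.** All denominators above are nonzero ($u_2,s_2,\alpha_2,\vartheta_3(0),\beta,\Delta_3-\Delta_1\neq0$). For all $C,\Gamma,t\in\mathbb R$ the following hold. (a) $\beta$ is real, $F_n$ and $\widetilde G_n$ are real for real $z$, $F_n$ has no real zero and is an entire function of $z$, and for all $n\in\mathbb Z$, $z\in\mathbb C$ $$f_nf_n^*+g_ng_n^*=F_{n+1}F_n,\quad \beta F_nf_n+G_ng_n^*=F_{n+1}f_{n-1},\quad \beta F_ng_n-G_nf_n^*=F_{n+1}g_{n-1},$$ $$H_{n+1}F_n-H_nF_{n+1}=f_n^*g_n,\quad \frac{dF_{n+1}}{dz}F_n-F_{n+1}\frac{dF_n}{dz}=g_ng_n^*,\quad G_nG_n^*=\widetilde G_n^2$$ (so $|G_n|^2=\widetilde G_n^2$ for real $z$). (b) Let $\varrho_n=\lim_{z\to0}\frac{G_n}{2\widetilde G_n}$ and, with all functions evaluated at $z=0$ and $D_n=f_nf_n^*+g_ng_n^*$, put $$\gamma_n=\begin{pmatrix}\frac{H_n+H_n^*}{F_n}\\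 \frac1i\frac{H_n-H_n^*}{F_n}\\ n-2\frac{\partial\log F_n}{\partial z}\end{pmatrix},\qquad T_n=\frac1{D_n}\begin{pmatrix}f_n^*g_n+f_ng_n^*\\ \frac1i(f_n^*g_n-f_ng_n^*)\\ f_nf_n^*-g_ng_n^*\end{pmatrix},$$ $$\widetilde N_n=\frac1{D_n}\begin{pmatrix}(f_n^{*2}-g_n^{*2})\varrho_n+(f_n^2-g_n^2)\varrho_n^*\\ \frac1i[(f_n^{*2}+g_n^{*2})\varrho_n-(f_n^2+g_n^2)\varrho_n^*]\\ -2(f_n^*g_n^*\varrho_n+f_ng_n\varrho_n^*)\end{pmatrix},\qquad \widetilde B_n=\frac1{D_n}\begin{pmatrix}\frac1i[-(f_n^{*2}-g_n^{*2})\varrho_n+(f_n^2-g_n^2)\varrho_n^*]\\ (f_n^{*2}+g_n^{*2})\varrho_n+(f_n^2+g_n^2)\varrho_n^*\\ \frac2i(f_n^*g_n^*\varrho_n-f_ng_n\varrho_n^*)\end{pmatrix}.$$ These vectors are real, and the discrete curve $\gamma$ has unit segment length: $\gamma_{n+1}-\gamma_n=T_n$ and $|\gamma_{n+1}-\gamma_n|=1$.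 (c) The number $\lambda=\frac1i\log(R_1R_3^{-1})$ (principal logarithm) is real, $\lambda\in(-\pi,\pi)\setminus\{0\}$, and it depends only on $v,r,y$. It is the (signed) torsion angle of $\gamma$, and $\kappa_n(t)=2\arctan\frac{\widetilde G_n(t,0)}{\beta F_n(t,0)}\in(-\pi,\pi)$ is its signed curvature angle, in the following sense: $\Phi_n=[T_n,\widetilde N_n,\widetilde B_n]\in SO(3)$, $T_n=\operatorname{sgn}(\lambda)\frac{\widetilde B_{n+1}\times\widetilde B_n}{|\widetilde B_{n+1}\times\widetilde B_n|}$, $\widetilde N_n=\widetilde B_n\times T_n$, $\langle\widetilde B_n,\widetilde B_{n-1}\rangle=\cos\lambda$, $\langle T_n,T_{n-1}\rangle=\cos\kappa_n$, and $$\Phi_{n+1}=\Phi_n\begin{pmatrix}1&0&0\\0&\cos\lambda&\sin\lambda\\0&-\sin\lambda&\cos\lambda\end{pmatrix}\begin{pmatrix}\cos\kappa_{n+1}&-\sin\kappa_{n+1}&0\\ \sin\kappa_{n+1}&\cos\kappa_{n+1}&0\\0&0&1\end{pmatrix}.$$ Moreover, for all $n$ and $t$, $\lambda=\frac1i\log\frac{G_n^*G_{n-1}}{\widetilde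 G_n\widetilde G_{n-1}}$ at $z=0$; at the exceptional $(n,t)$ where $\widetilde G_n(t,0)\widetilde G_{n-1}(t,0)=0$ the right-hand side is understood as its limit for $z\to0$, $z\ne0$. So the torsion angle depends neither on $n$ nor on $t$. (d) The signed curvature angle is $$\kappa_n(t)=2\arctan\left(-i\,\frac{\vartheta_1(iv)\,\vartheta_4(ivn-\frac12iv+it)}{\vartheta_3(iv)\,\vartheta_2(ivn-\frac12iv+it)}\right),$$ where the denominator is nonzero, the argument is real, and $\arctan$ takes values in $(-\frac\pi2,\frac\pi2)$. (e) If $k\in\mathbb N$ and $m\in\mathbb Z\setminus\{0\}$ satisfy $kv=my$, $$\exp\{\pi im(4r+1)\}(R_1R_3)^{-k}-1=0\qquad\text{and}\qquad\frac{(\Delta_3+\Delta_1)k-4\pi im}{\Delta_3-\Delta_1}=0,$$ then $\gamma$ is closed with period $k$, for every $t$: $\gamma_{n+k}=\gamma_n$ for all $n\in\mathbb Z$. For $t=0$ the same statements hold for the functions without deformation parameter. -/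

import Mathlib

open Filter Topology
open scoped ComplexConjugate

noncomputable section

namespace Kaleidocycle

/-! ### Jacobi theta functions -/

/-- `ϑ₁(x; w)`. -/
def theta1 (x w : ℂ) : ℂ :=
  -∑' n : ℤ, Complex.exp (Real.pi * Complex.I * w * ((n : ℂ) + 1 / 2) ^ 2
    + 2 * Real.pi * Complex.I * ((n : ℂ) + 1 / 2) * (x + 1 / 2))

/-- `ϑ₂(x; w)`. -/
def theta2 (x w : ℂ) : ℂ :=
  ∑' n : ℤ, Complex.exp (Real.pi * Complex.I * w * ((n : ℂ) + 1 / 2) ^ 2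
    + 2 * Real.pi * Complex.I * ((n : ℂ) + 1 / 2) * x)

/-- `ϑ₃(x; w)`. -/
def theta3 (x w : ℂ) : ℂ :=
  ∑' n : ℤ, Complex.exp (Real.pi * Complex.I * w * (n : ℂ) ^ 2
    + 2 * Real.pi * Complex.I * (n : ℂ) * x)

/-- `ϑ₄(x; w)`. -/
def theta4 (x w : ℂ) : ℂ :=
  ∑' n : ℤ, Complex.exp (Real.pi * Complex.I * w * (n : ℂ) ^ 2
    + 2 * Real.pi * Complex.I * (n : ℂ) * (x + 1 / 2))

/-- `ϑ₁(x; iy)`, and similarly below. -/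
def th1 (y : ℝ) (x : ℂ) : ℂ := theta1 x (Complex.I * y)
/-- `ϑ₂(x; iy)`. -/
def th2 (y : ℝ) (x : ℂ) : ℂ := theta2 x (Complex.I * y)
/-- `ϑ₃(x; iy)`. -/
def th3 (y : ℝ) (x : ℂ) : ℂ := theta3 x (Complex.I * y)
/-- `ϑ₄(x; iy)`. -/
def th4 (y : ℝ) (x : ℂ) : ℂ := theta4 x (Complex.I * y)

/-! ### Constants -/

/-- The point `-iv/2 + r`. -/
def pm (v r : ℝ) : ℂ := -(1 / 2) * Complex.I * v + r
/-- The point `iv/2 + r`. -/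
def pp (v r : ℝ) : ℂ := 1 / 2 * Complex.I * v + r

/-- `α₂ = √(ϑ₃(2r) ϑ₃(0))` (principal square root). -/
def alpha2 (r y : ℝ) : ℂ := (th3 y (2 * r) * th3 y 0) ^ (1 / 2 : ℂ)
/-- `β = ϑ₃(iv) / ϑ₃(0)`. -/
def beta (v y : ℝ) : ℂ := th3 y (Complex.I * v) / th3 y 0
/-- `s₂ = ϑ₃(2r) ϑ₁(iv)`. -/
def s2 (v r y : ℝ) : ℂ := th3 y (2 * r) * th1 y (Complex.I * v)
/-- `u₂ = ϑ₁(-iv/2+r) ϑ₃(-iv/2+r) ϑ₁(iv/2+r) ϑ₃(iv/2+r)`. -/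
def u2 (v r y : ℝ) : ℂ :=
  th1 y (pm v r) * th3 y (pm v r) * th1 y (pp v r) * th3 y (pp v r)

/-- `d₁(x; y) = ϑ₁'(x; iy) / ϑ₁(x; iy)`. -/
def d1 (y : ℝ) (x : ℂ) : ℂ := deriv (th1 y) x / th1 y x
/-- `d₃(x; y) = ϑ₃'(x; iy) / ϑ₃(x; iy)`. -/
def d3 (y : ℝ) (x : ℂ) : ℂ := deriv (th3 y) x / th3 y x

/-- `Δ₁`. -/
def Delta1 (v r y : ℝ) : ℂ := d1 y (pm v r) - d1 y (pp v r)
/-- `Δ₃`. -/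
def Delta3 (v r y : ℝ) : ℂ := d3 y (pm v r) - d3 y (pp v r)
/-- `R₁`. -/
def R1 (v r y : ℝ) : ℂ := th1 y (pm v r) / th1 y (pp v r)
/-- `R₃`. -/
def R3 (v r y : ℝ) : ℂ := th3 y (pm v r) / th3 y (pp v r)

/-- `λ = (1/i) log (R₁ R₃⁻¹)`, as a real number. -/
def lam (v r y : ℝ) : ℝ := (1 / Complex.I * Complex.log (R1 v r y * (R3 v r y)⁻¹)).re

/-! ### τ-functions and the associated framed discrete curve -/

/-- Families (indexed by `n ∈ ℤ`) of functions of a complex variable `z`. -/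
structure Tau where
  F : ℤ → ℂ → ℂ
  f : ℤ → ℂ → ℂ
  g : ℤ → ℂ → ℂ
  G : ℤ → ℂ → ℂ
  H : ℤ → ℂ → ℂ
  Gt : ℤ → ℂ → ℂ

/-- The conjugate `h^*` of a function of the complex variable `z`, `h^*(z) = conj (h (conj z))`.
It is the pointwise complex conjugate for real `z`. -/
def st (h : ℂ → ℂ) (z : ℂ) : ℂ := conj (h (conj z))

/-- The bilinear system defining τ-functions, with real constant `b`. -/
structure IsTau (τ : Tau) (b : ℂ) : Prop where
  real_const : b.im = 0
  /-- `F_n` and `G̃_n` take real values (on the real axis). -/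
  real_F : ∀ n (x : ℝ), (τ.F n x).im = 0
  real_Gt : ∀ n (x : ℝ), (τ.Gt n x).im = 0
  differentiable_F : ∀ n, Differentiable ℂ (τ.F n)
  i1 : ∀ n z, τ.f n z * st (τ.f n) z + τ.g n z * st (τ.g n) z = τ.F (n + 1) z * τ.F n z
  i2 : ∀ n z, b * τ.F n z * τ.f n z + τ.G n z * st (τ.g n) z = τ.F (n + 1) z * τ.f (n - 1) z
  i3 : ∀ n z, b * τ.F n z * τ.g n z - τ.G n z * st (τ.f n) z = τ.F (n + 1) z * τ.g (n - 1) z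
  i4 : ∀ n z, τ.H (n + 1) z * τ.F n z - τ.H n z * τ.F (n + 1) z = st (τ.f n) z * τ.g n z
  i5 : ∀ n z, deriv (τ.F (n + 1)) z * τ.F n z - τ.F (n + 1) z * deriv (τ.F n) z
    = τ.g n z * st (τ.g n) z
  i6 : ∀ n z, τ.G n z * st (τ.G n) z = τ.Gt n z ^ 2
  i6_real : ∀ n (x : ℝ), ((‖τ.G n x‖ ^ 2 : ℝ) : ℂ) = τ.Gt n x ^ 2

/-- `ϱ_n = G_n / (2 G̃_n)` at `z = 0`; a removable singularity there is filled in. -/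
def Tau.rho (τ : Tau) (n : ℤ) : ℂ :=
  limUnder (𝓝[≠] (0 : ℂ)) fun z => 1 / 2 * (τ.G n z / τ.Gt n z)

/-- `f_n f_n^* + g_n g_n^*` at `z = 0`. -/
def Tau.nrm (τ : Tau) (n : ℤ) : ℂ :=
  τ.f n 0 * conj (τ.f n 0) + τ.g n 0 * conj (τ.g n 0)

/-- The tangent, in complex notation (all coordinates are real numbers). -/
def Tau.tangentC (τ : Tau) (n : ℤ) : Fin 3 → ℂ :=
  let f := τ.f n 0
  let g := τ.g n 0
  let f' := conj f
  let g' := conj g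
  (τ.nrm n)⁻¹ • ![f' * g + f * g', 1 / Complex.I * (f' * g - f * g'), f * f' - g * g']

/-- The normal, in complex notation. -/
def Tau.normalC (τ : Tau) (n : ℤ) : Fin 3 → ℂ :=
  let f := τ.f n 0
  let g := τ.g n 0
  let f' := conj f
  let g' := conj g
  let ρ := τ.rho n
  let ρ' := conj ρ
  (τ.nrm n)⁻¹ • ![(f' ^ 2 - g' ^ 2) * ρ + (f ^ 2 - g ^ 2) * ρ',
    1 / Complex.I * ((f' ^ 2 + g' ^ 2) * ρ - (f ^ 2 + g ^ 2) * ρ'),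
    -2 * (f' * g' * ρ + f * g * ρ')]

/-- The binormal, in complex notation. -/
def Tau.binormalC (τ : Tau) (n : ℤ) : Fin 3 → ℂ :=
  let f := τ.f n 0
  let g := τ.g n 0
  let f' := conj f
  let g' := conj g
  let ρ := τ.rho n
  let ρ' := conj ρ
  (τ.nrm n)⁻¹ • ![1 / Complex.I * (-((f' ^ 2 - g' ^ 2) * ρ) + (f ^ 2 - g ^ 2) * ρ'),
    (f' ^ 2 + g' ^ 2) * ρ + (f ^ 2 + g ^ 2) * ρ',
    2 / Complex.I * (f' * g' * ρ - f * g * ρ')]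

/-- The discrete curve, in complex notation; `logDeriv h = h' / h`. -/
def Tau.curveC (τ : Tau) (n : ℤ) : Fin 3 → ℂ :=
  ![(τ.H n 0 + conj (τ.H n 0)) / τ.F n 0,
    1 / Complex.I * ((τ.H n 0 - conj (τ.H n 0)) / τ.F n 0),
    n - 2 * logDeriv (τ.F n) 0]

/-- The real vector with the same coordinates, for a complex vector with real coordinates. -/
def toReal (w : Fin 3 → ℂ) : EuclideanSpace ℝ (Fin 3) := WithLp.toLp 2 fun i => (w i).re

/-- `T_n`. -/
def Tau.tangent (τ : Tau) (n : ℤ) : EuclideanSpace ℝ (Fin 3) := toReal (τ.tangentC n)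
/-- `Ñ_n`. -/
def Tau.normal (τ : Tau) (n : ℤ) : EuclideanSpace ℝ (Fin 3) := toReal (τ.normalC n)
/-- `B̃_n`. -/
def Tau.binormal (τ : Tau) (n : ℤ) : EuclideanSpace ℝ (Fin 3) := toReal (τ.binormalC n)
/-- `γ_n`. -/
def Tau.curve (τ : Tau) (n : ℤ) : EuclideanSpace ℝ (Fin 3) := toReal (τ.curveC n)

/-- `(1/i) log (G_n^* G_{n-1} / (G̃_n G̃_{n-1}))` as a function of `z`. -/
def Tau.torsionExpr (τ : Tau) (n : ℤ) (z : ℂ) : ℂ :=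
  1 / Complex.I * Complex.log (st (τ.G n) z * τ.G (n - 1) z / (τ.Gt n z * τ.Gt (n - 1) z))

/-! ### Discrete Frenet frames, curvature and torsion angles -/

/-- The cross product on Euclidean 3-space. -/
def cross (a b : EuclideanSpace ℝ (Fin 3)) : EuclideanSpace ℝ (Fin 3) :=
  WithLp.toLp 2 (crossProduct (WithLp.ofLp a) (WithLp.ofLp b))

/-- The rotation `M₁(θ)` about the first axis. -/
def M1 (θ : ℝ) : Matrix (Fin 3) (Fin 3) ℝ :=
  !![1, 0, 0; 0, Real.cos θ, -Real.sin θ; 0, Real.sin θ, Real.cos θ]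

/-- The rotation `M₃(θ)` about the third axis. -/
def M3 (θ : ℝ) : Matrix (Fin 3) (Fin 3) ℝ :=
  !![Real.cos θ, -Real.sin θ, 0; Real.sin θ, Real.cos θ, 0; 0, 0, 1]

/-- The matrix with columns `T, N, B`. -/
def frame (T N B : EuclideanSpace ℝ (Fin 3)) : Matrix (Fin 3) (Fin 3) ℝ :=
  Matrix.of fun i j => ![T i, N i, B i] j

/-- `(T, N, B)` is a discrete Frenet frame of the unit segment length discrete curve `γ`,
with torsion angles `l n` and signed curvature angles `κ n`.
The torsion angle is counted with a sign. When it is positive, `frenet` and `tangent_eq` are the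
usual normalisation `T_n = (B_{n+1} × B_n) / |B_{n+1} × B_n|`. -/
structure IsFrenetFramed (γ T N B : ℤ → EuclideanSpace ℝ (Fin 3)) (l κ : ℤ → ℝ) : Prop where
  special_orthogonal : ∀ n, frame (T n) (N n) (B n) ∈ Matrix.specialOrthogonalGroup (Fin 3) ℝ
  curve_succ : ∀ n, γ (n + 1) = γ n + T n
  tangent_eq : ∀ n, T n =
    (Real.sign (l (n + 1)) * ‖cross (B (n + 1)) (B n)‖⁻¹) • cross (B (n + 1)) (B n)
  normal_eq : ∀ n, N n = cross (B n) (T n)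
  frenet : ∀ n, frame (T (n + 1)) (N (n + 1)) (B (n + 1))
    = frame (T n) (N n) (B n) * (M1 (-l (n + 1)) * M3 (κ (n + 1)))
  curvature_angle : ∀ n, inner ℝ (T n) (T (n - 1)) = Real.cos (κ n)
  curvature_range : ∀ n, -Real.pi < κ n ∧ κ n < Real.pi
  torsion_angle : ∀ n, inner ℝ (B n) (B (n - 1)) = Real.cos (l n)
  torsion_range : ∀ n, -Real.pi < l n ∧ l n < Real.pi ∧ l n ≠ 0

/-! ### The explicit τ-functions -/

/-- `μ_n = ivn + z / (Δ₃ - Δ₁)`. -/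
def mu (v r y : ℝ) (n : ℤ) (z : ℂ) : ℂ :=
  Complex.I * v * n + z / (Delta3 v r y - Delta1 v r y)

/-- `exp (a Δ₃ z / (Δ₃ - Δ₁) + C t z / 2 + c Γ i t)`. -/
def ex (v r y C Γ t : ℝ) (a c z : ℂ) : ℂ :=
  Complex.exp (a * Delta3 v r y / (Delta3 v r y - Delta1 v r y) * z + C / 2 * t * z
    + c * Γ * Complex.I * t)

/-- The τ-functions built from theta functions, at deformation parameter `t`. -/
def thetaTau (v r y C Γ t : ℝ) : Tau where
  F n z := alpha2 r y * ex v r y C Γ t n 0 z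
    * th2 y (mu v r y n z - 1 / 2 * Complex.I * v + Complex.I * t)
  f n z := th3 y (pm v r) * R3 v r y ^ n * ex v r y C Γ t (n + 1 / 2) (-(1 / 2)) z
    * th2 y (mu v r y n z + r + Complex.I * t)
  g n z := th1 y (pp v r) * R1 v r y ^ (-n) * ex v r y C Γ t (n + 1 / 2) (1 / 2) z
    * th4 y (mu v r y n z - r + Complex.I * t)
  G n z := alpha2 r y * (th1 y (Complex.I * v) / th3 y 0) * R1 v r y ^ (-n) * R3 v r y ^ n
    * ex v r y C Γ t n 0 z
    * th4 y (mu v r y n z - 1 / 2 * Complex.I * v + Complex.I * t)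
  H n z := u2 v r y / (alpha2 r y * s2 v r y) * R1 v r y ^ (-n) * R3 v r y ^ (-n)
    * ex v r y C Γ t n 1 z
    * th4 y (mu v r y n z - 1 / 2 * Complex.I * v - 2 * r + Complex.I * t)
  Gt n z := -Complex.I * alpha2 r y * (th1 y (Complex.I * v) / th3 y 0)
    * ex v r y C Γ t n 0 z
    * th4 y (mu v r y n z - 1 / 2 * Complex.I * v + Complex.I * t)

/-- `G̃_n(t,0) / (β F_n(t,0))`, the argument of the arctangent. -/
def curvRatio (v r y C Γ t : ℝ) (n : ℤ) : ℂ :=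
  (thetaTau v r y C Γ t).Gt n 0 / (beta v y * (thetaTau v r y C Γ t).F n 0)

/-- The signed curvature angle `κ_n(t) = 2 arctan (G̃_n(t,0) / (β F_n(t,0)))`. -/
def kappa (v r y C Γ t : ℝ) (n : ℤ) : ℝ := 2 * Real.arctan (curvRatio v r y C Γ t n).re

/-- `-i ϑ₁(iv) ϑ₄(ivn - iv/2 + it) / (ϑ₃(iv) ϑ₂(ivn - iv/2 + it))`. -/
def thetaRatio (v y t : ℝ) (n : ℤ) : ℂ :=
  -Complex.I *
    (th1 y (Complex.I * v)
        * th4 y (Complex.I * v * n - 1 / 2 * Complex.I * v + Complex.I * t)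
      / (th3 y (Complex.I * v)
        * th2 y (Complex.I * v * n - 1 / 2 * Complex.I * v + Complex.I * t)))

/-- The closure conditions `Λ = 0` and `Ξ = 0` together with `kv = my`, `m ≠ 0`. -/
def ClosureCondition (v r y : ℝ) (k : ℕ) (m : ℤ) : Prop :=
  m ≠ 0 ∧ (k : ℝ) * v = m * y ∧
  Complex.exp (Real.pi * Complex.I * m * (4 * r + 1)) * (R1 v r y * R3 v r y) ^ (-(k : ℤ)) - 1 = 0 ∧
  ((Delta3 v r y + Delta1 v r y) * k - 4 * Real.pi * Complex.I * m)
    / (Delta3 v r y - Delta1 v r y) = 0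

/-- A discrete curve is closed with period `k`. -/
def IsClosedWithPeriod (γ : ℤ → EuclideanSpace ℝ (Fin 3)) (k : ℕ) : Prop :=
  ∀ n, γ (n + k) = γ n

end Kaleidocycle

end

open Filter Topology
open scoped ComplexConjugate

noncomputable section

namespace Kaleidocycle

/-! ### Elementary properties of the theta functions -/

/-! The analysis rests on product formulas. Splitting a double theta series by the parity of the sum
of its two indices turns a product of theta functions at `x + z` and `x - z` with parameter `iy`
into a bilinear form in theta functions of `2x` and `2z` with parameter `2iy` (`th3_mul_th3` and its
variants). Identities between products of four theta functions thereby become polynomial identities.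
Two of these, `theta_identity_four_term` and `theta_identity_three_term`, specialised and translated
by the half period `(1 + iy) / 2`, which exchanges `ϑ₁` with `ϑ₃` and `ϑ₂` with `ϑ₄` up to factors,
give the first four bilinear equations. The equation for `dF/dz` combines `theta_identity_norm` with
its derivative in `s`.

Nonvanishing comes from positivity: `ϑ₃` is a sum of positive terms on the imaginary axis, the
functional equation carries this to the real axis, real zeros of `ϑ₂` are located by doubling `y`
repeatedly, and at `r ± is` the addition formulas become sums of squares. Hence `Δ₃ - Δ₁ ≠ 0`. Since
conjugation exchanges `a` and `b`, `R₁ / R₃` has modulus one, and an addition formula shows that it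
is not `±1`.

The geometry is that of spinors. `T_n` is the Hopf image of `(f_n, g_n)`, and `Ñ_n - i B̃_n` is an
isotropic vector, quadratic in the conjugate spinor. The second and third bilinear equations say
that passing from index `n` to `n - 1` multiplies the spinor by a positive multiple of an element of
`SU(2)`, so the frame rotates by twice an arctangent. The relation `G_n = i (R₁ / R₃)^(-n) G̃_n`
makes the phase of `ϱ_n` advance by the constant `λ`, which is the torsion angle
(`Tau.frame_transfer`). The equations for `H` and `dF/dz` express `T_n` as a difference of the
explicit curve (`IsTau.curveC_succ`).

If `kv = my`, passing from `n` to `n + k` moves the theta arguments by `m` periods. `F` and `H`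
acquire explicit factors, and the two remaining closure conditions say precisely that these leave
the curve unchanged. -/

theorem exp_pi_I_half : Complex.exp (Real.pi * Complex.I * (1 / 2)) = Complex.I := by
  refine Eq.trans ?_ Complex.exp_pi_div_two_mul_I
  congr 1
  ring

theorem I_mul_ofReal_im_pos {y : ℝ} (hy : 0 < y) : 0 < (Complex.I * (y : ℂ)).im := by
  simpa using hy

theorem th3_eq_jacobiTheta₂ (y : ℝ) (x : ℂ) : th3 y x = jacobiTheta₂ x (Complex.I * y) := by
  refine tsum_congr fun n => ?_
  rw [jacobiTheta₂_term]
  congr 1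
  ring

theorem th4_eq_th3 (y : ℝ) (x : ℂ) : th4 y x = th3 y (x + 1 / 2) := rfl

/-- Completing the square in the exponent; through this the symmetries of `ϑ₂` are inherited from
`jacobiTheta₂`. -/
theorem th2_eq_th3 (y : ℝ) (x : ℂ) :
    th2 y x = Complex.exp (-(Real.pi * y / 4) + Real.pi * Complex.I * x)
      * th3 y (x + Complex.I * y / 2) := by
  rw [th2, theta2, th3, theta3, ← tsum_mul_left]
  refine tsum_congr fun n => ?_
  rw [← Complex.exp_add]
  congr 1
  linear_combination Real.pi * y / 4 * Complex.I_sq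

theorem th1_eq_th2 (y : ℝ) (x : ℂ) : th1 y x = -th2 y (x + 1 / 2) := rfl

theorem th3_neg (y : ℝ) (x : ℂ) : th3 y (-x) = th3 y x := by
  simp only [th3_eq_jacobiTheta₂, jacobiTheta₂_neg_left]

theorem th3_add_one (y : ℝ) (x : ℂ) : th3 y (x + 1) = th3 y x := by
  simp only [th3_eq_jacobiTheta₂, jacobiTheta₂_add_left]

theorem th3_add_period (y : ℝ) (x : ℂ) :
    th3 y (x + Complex.I * y) = Complex.exp (Real.pi * y - 2 * Real.pi * Complex.I * x)
      * th3 y x := by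
  simp only [th3_eq_jacobiTheta₂, jacobiTheta₂_add_left']
  congr 2
  linear_combination (-(Real.pi * y : ℂ)) * Complex.I_sq

theorem th2_neg (y : ℝ) (x : ℂ) : th2 y (-x) = th2 y x := by
  rw [th2_eq_th3, th2_eq_th3, ← th3_neg,
    show x + Complex.I * y / 2 = -(-x + Complex.I * y / 2) + Complex.I * y by ring,
    th3_add_period, ← mul_assoc, ← Complex.exp_add]
  congr 2
  linear_combination (-Real.pi * y : ℂ) * Complex.I_sq

theorem th2_add_one (y : ℝ) (x : ℂ) : th2 y (x + 1) = -th2 y x := by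
  rw [th2_eq_th3, th2_eq_th3, show x + 1 + Complex.I * y / 2 = x + Complex.I * y / 2 + 1 by ring,
    th3_add_one, ← neg_mul, mul_add, mul_one, ← add_assoc, Complex.exp_add _ (Real.pi * Complex.I),
    Complex.exp_pi_mul_I, mul_neg_one]

theorem th1_neg (y : ℝ) (x : ℂ) : th1 y (-x) = -th1 y x := by
  rw [th1_eq_th2, th1_eq_th2, show x + 1 / 2 = -(-x + 1 / 2) + 1 by ring, th2_add_one, th2_neg]
  ring

theorem th4_neg (y : ℝ) (x : ℂ) : th4 y (-x) = th4 y x := by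
  rw [th4_eq_th3, th4_eq_th3, ← th3_neg, show x + 1 / 2 = -(-x + 1 / 2) + 1 by ring, th3_add_one]

theorem th1_zero (y : ℝ) : th1 y 0 = 0 := by
  have h := th1_neg y 0
  rw [neg_zero] at h
  linear_combination h / 2

/-! ### The quasi-period `(1 + iy) / 2` -/

/-- The half period `(1 + iy) / 2`. -/
def halfPeriod (y : ℝ) : ℂ := 1 / 2 + Complex.I * y / 2

/-- The factor by which the theta functions are multiplied under translation by `halfPeriod`. -/
def shiftFactor (y : ℝ) (x : ℂ) : ℂ := Complex.exp (Real.pi * y / 4 - Real.pi * Complex.I * x)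

theorem shiftFactor_ne_zero (y : ℝ) (x : ℂ) : shiftFactor y x ≠ 0 := Complex.exp_ne_zero _

/-- This translation permutes the four functions, `ϑ₁` with `ϑ₃` and `ϑ₂` with `ϑ₄`, up to a fourth
root of unity and `shiftFactor`. One theta identity therefore yields others. -/
theorem th3_add_halfPeriod (y : ℝ) (x : ℂ) :
    th3 y (x + halfPeriod y) = Complex.I * shiftFactor y x * th1 y x := by
  rw [th1_eq_th2, th2_eq_th3, shiftFactor, halfPeriod, ← add_assoc]
  have h : Complex.exp (Real.pi * y / 4 - Real.pi * Complex.I * x)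
      * Complex.exp (-(Real.pi * y / 4) + Real.pi * Complex.I * (x + 1 / 2)) = Complex.I := by
    rw [← Complex.exp_add]
    refine Eq.trans ?_ exp_pi_I_half
    congr 1
    ring
  linear_combination (th3 y (x + 1 / 2 + Complex.I * y / 2)) * Complex.I_sq
    + Complex.I * th3 y (x + 1 / 2 + Complex.I * y / 2) * h

theorem th4_add_halfPeriod (y : ℝ) (x : ℂ) :
    th4 y (x + halfPeriod y) = shiftFactor y x * th2 y x := by
  rw [th4_eq_th3, th2_eq_th3, shiftFactor, halfPeriod,
    show x + (1 / 2 + Complex.I * y / 2) + 1 / 2 = x + Complex.I * y / 2 + 1 by ring, th3_add_one,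
    ← mul_assoc, ← Complex.exp_add, sub_add_add_cancel, add_neg_cancel, Complex.exp_zero, one_mul]

theorem th2_add_halfPeriod (y : ℝ) (x : ℂ) :
    th2 y (x + halfPeriod y) = -Complex.I * shiftFactor y x * th4 y x := by
  have h : Complex.exp (-(Real.pi * y / 4) + Real.pi * Complex.I * (x + halfPeriod y))
      * Complex.exp (Real.pi * y - 2 * Real.pi * Complex.I * (x + 1 / 2))
      = -Complex.I * shiftFactor y x := by
    have h1 : -Complex.I = Complex.exp (-(Real.pi * Complex.I * (1 / 2))) := by
      rw [Complex.exp_neg, exp_pi_I_half, Complex.inv_I]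
    rw [h1, shiftFactor, ← Complex.exp_add, ← Complex.exp_add, halfPeriod]
    congr 1
    linear_combination Real.pi * y / 2 * Complex.I_sq
  rw [th4_eq_th3, th2_eq_th3, show x + halfPeriod y + Complex.I * y / 2
    = x + 1 / 2 + Complex.I * y by rw [halfPeriod]; ring, th3_add_period, ← mul_assoc, h]

theorem th1_add_halfPeriod (y : ℝ) (x : ℂ) :
    th1 y (x + halfPeriod y) = shiftFactor y x * th3 y x := by
  have h := th2_add_halfPeriod y (x + 1 / 2)
  rw [th4_eq_th3, show x + 1 / 2 + 1 / 2 = x + 1 by ring, th3_add_one] at h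
  have h2 : shiftFactor y (x + 1 / 2) * Complex.I = shiftFactor y x := by
    nth_rw 1 [← exp_pi_I_half]
    rw [shiftFactor, shiftFactor, ← Complex.exp_add]
    congr 1
    ring
  rw [th1_eq_th2, show x + halfPeriod y + 1 / 2 = x + 1 / 2 + halfPeriod y by ring, h, ← h2]
  ring

/-! ### Integer multiples of the period -/

theorem th3_add_int_mul_period (y : ℝ) (x : ℂ) (m : ℤ) :
    th3 y (x + Complex.I * y * m) = Complex.exp (Real.pi * y * m ^ 2
      - 2 * Real.pi * Complex.I * m * x) * th3 y x := by
  induction m with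
  | zero => simp
  | succ m ih =>
    push_cast at ih ⊢
    rw [show x + Complex.I * y * (m + 1) = x + Complex.I * y * m + Complex.I * y by ring,
      th3_add_period, ih, ← mul_assoc, ← Complex.exp_add]
    congr 2
    linear_combination (-2 * Real.pi * y * m : ℂ) * Complex.I_sq
  | pred m ih =>
    push_cast at ih ⊢
    rw [show x + Complex.I * y * -m = x + Complex.I * y * (-m - 1) + Complex.I * y by ring,
      th3_add_period] at ih
    refine mul_left_cancel₀ (Complex.exp_ne_zero _) (ih.trans ?_)
    rw [← mul_assoc, ← Complex.exp_add]
    congr 2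
    linear_combination (2 * Real.pi * y * (-m - 1) : ℂ) * Complex.I_sq

/-- The extra factor comes from the shift by `1 / 2` in `ϑ₄`; it is the source of the `+ 1` in the
closure factor `exp (πim(4r + 1))`. -/
theorem th4_add_int_mul_period (y : ℝ) (x : ℂ) (m : ℤ) :
    th4 y (x + Complex.I * y * m) = Complex.exp (Real.pi * y * m ^ 2
      - 2 * Real.pi * Complex.I * m * x) * Complex.exp (-(Real.pi * Complex.I * m)) * th4 y x := by
  rw [th4_eq_th3, th4_eq_th3, show x + Complex.I * y * m + 1 / 2 = x + 1 / 2 + Complex.I * y * m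
    by ring, th3_add_int_mul_period, ← Complex.exp_add]
  congr 2
  ring

theorem th2_add_int_mul_period (y : ℝ) (x : ℂ) (m : ℤ) :
    th2 y (x + Complex.I * y * m) = Complex.exp (Real.pi * y * m ^ 2
      - 2 * Real.pi * Complex.I * m * x) * th2 y x := by
  rw [th2_eq_th3, th2_eq_th3, show x + Complex.I * y * m + Complex.I * y / 2
    = x + Complex.I * y / 2 + Complex.I * y * m by ring, th3_add_int_mul_period, ← mul_assoc,
    ← mul_assoc, ← Complex.exp_add, ← Complex.exp_add]
  congr 2
  ring

/-! ### Conjugation -/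

theorem conj_th3 (y : ℝ) (x : ℂ) : conj (th3 y x) = th3 y (conj x) := by
  simp [th3_eq_jacobiTheta₂, jacobiTheta₂_conj]

theorem conj_th4 (y : ℝ) (x : ℂ) : conj (th4 y x) = th4 y (conj x) := by
  simp [th4_eq_th3, conj_th3, Complex.conj_ofNat]

theorem conj_th2 (y : ℝ) (x : ℂ) : conj (th2 y x) = th2 y (conj x) := by
  rw [← th2_neg y (conj x), th2_eq_th3, th2_eq_th3, map_mul, conj_th3, ← th3_neg,
    ← Complex.exp_conj]
  simp only [map_add, map_neg, map_mul, map_div₀, Complex.conj_ofReal, Complex.conj_I,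
    Complex.conj_ofNat]
  congr 2 <;> ring

theorem conj_th1 (y : ℝ) (x : ℂ) : conj (th1 y x) = th1 y (conj x) := by
  simp [th1_eq_th2, conj_th2, Complex.conj_ofNat]

/-! ### Differentiability -/

theorem differentiable_th3 {y : ℝ} (hy : 0 < y) : Differentiable ℂ (th3 y) := by
  intro x
  rw [show th3 y = (jacobiTheta₂ · (Complex.I * y)) from funext (th3_eq_jacobiTheta₂ y)]
  exact differentiableAt_jacobiTheta₂_fst x (I_mul_ofReal_im_pos hy)

theorem differentiable_th4 {y : ℝ} (hy : 0 < y) : Differentiable ℂ (th4 y) :=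
  (differentiable_th3 hy).comp (differentiable_id.add_const _)

theorem differentiable_th2 {y : ℝ} (hy : 0 < y) : Differentiable ℂ (th2 y) := by
  rw [show th2 y = _ from funext (th2_eq_th3 y)]
  have := differentiable_th3 hy
  fun_prop

theorem differentiable_th1 {y : ℝ} (hy : 0 < y) : Differentiable ℂ (th1 y) :=
  ((differentiable_th2 hy).comp (differentiable_id.add_const _)).neg

/-! ### Product formulas -/

/-- `(j, k) ↦ (j + k, j - k)` and `(j, k) ↦ (j + k + 1, j - k)` together enumerate the pairs of
integers. -/
def intPairParity : (ℤ × ℤ) ⊕ (ℤ × ℤ) ≃ ℤ × ℤ where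
  toFun := Sum.elim (fun p => (p.1 + p.2, p.1 - p.2)) (fun p => (p.1 + p.2 + 1, p.1 - p.2))
  invFun p := if (p.1 + p.2) % 2 = 0 then Sum.inl ((p.1 + p.2) / 2, (p.1 - p.2) / 2)
    else Sum.inr ((p.1 + p.2) / 2, (p.1 - p.2) / 2)
  left_inv := by
    rintro (⟨j, k⟩ | ⟨j, k⟩)
    · have h : (j + k + (j - k)) % 2 = 0 := by omega
      simp only [Sum.elim_inl, h, if_true, Sum.inl.injEq, Prod.mk.injEq]
      omega
    · have h : ¬(j + k + 1 + (j - k)) % 2 = 0 := by omega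
      simp only [Sum.elim_inr, h, if_false, Sum.inr.injEq, Prod.mk.injEq]
      omega
  right_inv := by
    rintro ⟨m, n⟩
    by_cases h : (m + n) % 2 = 0
    · simp only [h, if_true, Sum.elim_inl, Prod.mk.injEq]
      omega
    · simp only [h, if_false, Sum.elim_inr, Prod.mk.injEq]
      omega

theorem summable_th3 {y : ℝ} (hy : 0 < y) (x : ℂ) :
    Summable fun n : ℤ => Complex.exp (Real.pi * Complex.I * (Complex.I * y) * (n : ℂ) ^ 2
      + 2 * Real.pi * Complex.I * (n : ℂ) * x) := by
  refine ((summable_jacobiTheta₂_term_iff x _).mpr (I_mul_ofReal_im_pos hy)).congr fun n => ?_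
  rw [jacobiTheta₂_term]
  congr 1
  ring

theorem summable_th2 {y : ℝ} (hy : 0 < y) (x : ℂ) :
    Summable fun n : ℤ => Complex.exp (Real.pi * Complex.I * (Complex.I * y) * ((n : ℂ) + 1 / 2) ^ 2
      + 2 * Real.pi * Complex.I * ((n : ℂ) + 1 / 2) * x) := by
  refine ((summable_th3 hy (x + Complex.I * y / 2)).mul_left
    (Complex.exp (-(Real.pi * y / 4) + Real.pi * Complex.I * x))).congr fun n => ?_
  rw [← Complex.exp_add]
  congr 1
  linear_combination (-Real.pi * y / 4 : ℂ) * Complex.I_sq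

/-- For indices `j + k, j - k` the squares add up to `2j² + 2k²`; for `j + k + 1, j - k` they add up
to `2(j + 1/2)² + 2(k + 1/2)²`. The even part of the double series is thus a product of two `ϑ₃`,
the odd part a product of two `ϑ₂`, with doubled parameter. -/
theorem th3_mul_th3 {y : ℝ} (hy : 0 < y) (x z : ℂ) :
    th3 y (x + z) * th3 y (x - z) = th3 (2 * y) (2 * x) * th3 (2 * y) (2 * z)
      + th2 (2 * y) (2 * x) * th2 (2 * y) (2 * z) := by
  have hy2 : 0 < 2 * y := by positivity
  have s1 := (summable_th3 hy (x + z)).norm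
  have s2 := (summable_th3 hy (x - z)).norm
  have h3 := tsum_mul_tsum_of_summable_norm (summable_th3 hy2 (2 * x)).norm
    (summable_th3 hy2 (2 * z)).norm
  have h2 := tsum_mul_tsum_of_summable_norm (summable_th2 hy2 (2 * x)).norm
    (summable_th2 hy2 (2 * z)).norm
  have e3 := summable_mul_of_summable_norm (summable_th3 hy2 (2 * x)).norm
    (summable_th3 hy2 (2 * z)).norm
  have e2 := summable_mul_of_summable_norm (summable_th2 hy2 (2 * x)).norm
    (summable_th2 hy2 (2 * z)).norm
  simp only [th3, theta3, th2, theta2]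
  rw [tsum_mul_tsum_of_summable_norm s1 s2, h3, h2, ← intPairParity.tsum_eq]
  refine (HasSum.sum (e3.hasSum.congr_fun fun p => ?_) (e2.hasSum.congr_fun fun p => ?_)).tsum_eq
  · simp only [intPairParity, Function.comp_apply, Equiv.coe_fn_mk, Sum.elim_inl]
    rw [← Complex.exp_add, ← Complex.exp_add]
    congr 1
    push_cast
    ring
  · simp only [intPairParity, Function.comp_apply, Equiv.coe_fn_mk, Sum.elim_inr]
    rw [← Complex.exp_add, ← Complex.exp_add]
    congr 1
    push_cast
    ring

theorem th4_mul_th4 {y : ℝ} (hy : 0 < y) (x z : ℂ) :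
    th4 y (x + z) * th4 y (x - z) = th3 (2 * y) (2 * x) * th3 (2 * y) (2 * z)
      - th2 (2 * y) (2 * x) * th2 (2 * y) (2 * z) := by
  rw [th4_eq_th3, th4_eq_th3, add_right_comm, sub_add_eq_add_sub, th3_mul_th3 hy,
    show 2 * (x + 1 / 2) = 2 * x + 1 by ring, th3_add_one, th2_add_one]
  ring

/-- Translate `x` by `iy/2` in the formula for `ϑ₃`: then `2x` moves by `iy`, half the period `2iy`,
and this exchanges `ϑ₂` and `ϑ₃` of the doubled parameter. -/
theorem th2_mul_th2 {y : ℝ} (hy : 0 < y) (x z : ℂ) :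
    th2 y (x + z) * th2 y (x - z) = th3 (2 * y) (2 * x) * th2 (2 * y) (2 * z)
      + th2 (2 * y) (2 * x) * th3 (2 * y) (2 * z) := by
  have h := th3_mul_th3 hy (x + Complex.I * y / 2) z
  have hA : th2 (2 * y) (2 * x) = Complex.exp (-(Real.pi * y / 2) + 2 * Real.pi * Complex.I * x)
      * th3 (2 * y) (2 * (x + Complex.I * y / 2)) := by
    rw [th2_eq_th3]
    push_cast
    congr 2 <;> ring
  have hB : th3 (2 * y) (2 * x) = Complex.exp (-(Real.pi * y / 2) + 2 * Real.pi * Complex.I * x)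
      * th2 (2 * y) (2 * (x + Complex.I * y / 2)) := by
    rw [th2_eq_th3, show 2 * (x + Complex.I * y / 2) + Complex.I * ↑(2 * y) / 2
      = 2 * x + Complex.I * ↑(2 * y) by push_cast; ring, th3_add_period, ← mul_assoc, ← mul_assoc,
      ← Complex.exp_add, ← Complex.exp_add]
    nth_rw 1 [← one_mul (th3 _ _), ← Complex.exp_zero]
    congr 2
    push_cast
    linear_combination (-Real.pi * y : ℂ) * Complex.I_sq
  have hE : Complex.exp (-(Real.pi * y / 4) + Real.pi * Complex.I * (x + z))
      * Complex.exp (-(Real.pi * y / 4) + Real.pi * Complex.I * (x - z))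
      = Complex.exp (-(Real.pi * y / 2) + 2 * Real.pi * Complex.I * x) := by
    rw [← Complex.exp_add]
    congr 1
    ring
  rw [th2_eq_th3, th2_eq_th3 y (x - z), hA, hB, ← hE,
    show x + z + Complex.I * y / 2 = x + Complex.I * y / 2 + z by ring,
    show x - z + Complex.I * y / 2 = x + Complex.I * y / 2 - z by ring]
  linear_combination Complex.exp (-(Real.pi * y / 4) + Real.pi * Complex.I * (x + z))
      * Complex.exp (-(Real.pi * y / 4) + Real.pi * Complex.I * (x - z)) * h

theorem th1_mul_th1 {y : ℝ} (hy : 0 < y) (x z : ℂ) :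
    th1 y (x + z) * th1 y (x - z) = th3 (2 * y) (2 * x) * th2 (2 * y) (2 * z)
      - th2 (2 * y) (2 * x) * th3 (2 * y) (2 * z) := by
  rw [th1_eq_th2, th1_eq_th2, neg_mul_neg, add_right_comm, sub_add_eq_add_sub, th2_mul_th2 hy,
    show 2 * (x + 1 / 2) = 2 * x + 1 by ring, th3_add_one, th2_add_one]
  ring

/-! ### Four-theta identities -/

/-- The product formulas make both sides polynomials in the values of `ϑ₂` and `ϑ₃` at `2a`, `2b`,
`2c`, `2d`. The content is that the left side is symmetric in `b` and `d`. -/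
theorem theta_identity_four_term {y : ℝ} (hy : 0 < y) (a b c d : ℂ) :
    th3 y (a + b) * th3 y (a - b) * (th2 y (c + d) * th2 y (c - d))
      + th1 y (a + b) * th1 y (a - b) * (th4 y (c + d) * th4 y (c - d))
    = th3 y (a + d) * th3 y (a - d) * (th2 y (c + b) * th2 y (c - b))
      + th1 y (a + d) * th1 y (a - d) * (th4 y (c + b) * th4 y (c - b)) := by
  simp only [th1_mul_th1 hy, th2_mul_th2 hy, th3_mul_th3 hy, th4_mul_th4 hy]
  ring

theorem theta_identity_three_term {y : ℝ} (hy : 0 < y) (a b c d : ℂ) :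
    th3 y (a + b) * th3 y (a - b) * (th2 y (c + d) * th2 y (c - d))
      - th3 y (d + b) * th3 y (d - b) * (th2 y (c + a) * th2 y (c - a))
    = th1 y (a + d) * th1 y (a - d) * (th4 y (c + b) * th4 y (c - b)) := by
  simp only [th1_mul_th1 hy, th2_mul_th2 hy, th3_mul_th3 hy, th4_mul_th4 hy]
  ring

/-- Taking `d = a` makes the last term of the four-term identity vanish with `ϑ₁(0)`. This is the
source of `f f^* + g g^* = F_{n+1} F_n`. -/
theorem theta_identity_norm {y : ℝ} (hy : 0 < y) (r s x : ℂ) :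
    th3 y (r - s) * th3 y (r + s) * (th2 y (x + r) * th2 y (x - r))
      + th1 y (r - s) * th1 y (r + s) * (th4 y (x + r) * th4 y (x - r))
    = th3 y (2 * r) * th3 y 0 * (th2 y (x + s) * th2 y (x - s)) := by
  have h := theta_identity_four_term hy r s x r
  rw [← two_mul, sub_self, th1_zero] at h
  linear_combination h

theorem theta_identity_transfer_even {y : ℝ} (hy : 0 < y) (r s x : ℂ) :
    th3 y (2 * s) * th3 y (r - s) * (th2 y (x - s) * th2 y (x + r))
      + th1 y (2 * s) * th1 y (r - s) * (th4 y (x - s) * th4 y (x + r))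
    = th3 y 0 * th3 y (r + s) * (th2 y (x + s) * th2 y (x - 2 * s + r)) := by
  -- With `r', s', x'` the new arguments, `r' - s' = r - s`, `r' + s' = 2s`, `x' + r' = x + r`, `x'
  -- - r' = x - s`, `x' + s' = x + s` and `x' - s' = x - 2s + r`.
  have h := theta_identity_norm hy ((r + s) / 2) ((3 * s - r) / 2) (x + (r - s) / 2)
  ring_nf at h ⊢
  linear_combination h

/-- The shift factors of a product depend only on the sum of the arguments, so they are common to
all terms of a homogeneous theta identity. -/
theorem shiftFactor_mul (y : ℝ) (a b c d : ℂ) (h : a + b = c + d) :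
    shiftFactor y a * shiftFactor y b = shiftFactor y c * shiftFactor y d := by
  rw [shiftFactor, shiftFactor, shiftFactor, shiftFactor, ← Complex.exp_add, ← Complex.exp_add]
  congr 1
  linear_combination (-Real.pi * Complex.I : ℂ) * h

/-- The even identity with `r` replaced by `-r + halfPeriod y`, which exchanges the roles of the
theta functions containing `r`. -/
theorem theta_identity_transfer_odd {y : ℝ} (hy : 0 < y) (r s x : ℂ) :
    th3 y (2 * s) * th1 y (r + s) * (th2 y (x - s) * th4 y (x - r))
      - th1 y (2 * s) * th3 y (r + s) * (th4 y (x - s) * th2 y (x - r))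
    = th3 y 0 * th1 y (r - s) * (th2 y (x + s) * th4 y (x - 2 * s - r)) := by
  have h := theta_identity_transfer_even hy (-r + halfPeriod y) s x
  rw [show -r + halfPeriod y - s = -(r + s) + halfPeriod y by ring,
    show x + (-r + halfPeriod y) = x - r + halfPeriod y by ring,
    show -r + halfPeriod y + s = -(r - s) + halfPeriod y by ring,
    show x - 2 * s + (-r + halfPeriod y) = x - 2 * s - r + halfPeriod y by ring,
    th3_add_halfPeriod, th2_add_halfPeriod, th1_add_halfPeriod, th4_add_halfPeriod,
    th3_add_halfPeriod, th2_add_halfPeriod, th1_neg, th3_neg, th1_neg] at h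
  have e := shiftFactor_mul y (-(r + s)) (x - r) (-(r - s)) (x - 2 * s - r) (by ring)
  refine mul_left_cancel₀ (mul_ne_zero (shiftFactor_ne_zero y (-(r + s)))
    (shiftFactor_ne_zero y (x - r))) ?_
  linear_combination -h - (th3 y 0 * th1 y (r - s) * (th2 y (x + s) * th4 y (x - 2 * s - r))) * e
    + (shiftFactor y (-(r + s)) * shiftFactor y (x - r)
        * (th3 y (2 * s) * th1 y (r + s) * (th2 y (x - s) * th4 y (x - r)))
      - shiftFactor y (-(r - s)) * shiftFactor y (x - 2 * s - r)
        * (th3 y 0 * th1 y (r - s) * (th2 y (x + s) * th4 y (x - 2 * s - r)))) * Complex.I_sq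

/-- In the three-term identity every argument is moved by half of `halfPeriod`: sums then gain one
`halfPeriod` and differences none, so pairs of equal theta functions become mixed pairs. -/
theorem theta_identity_duplication {y : ℝ} (hy : 0 < y) (a b x : ℂ) :
    th1 y b * th3 y b * (th4 y (x - a) * th2 y (x + a))
      - th1 y a * th3 y a * (th4 y (x - b) * th2 y (x + b))
    = th3 y (a + b) * th1 y (b - a) * (th2 y x * th4 y x) := by
  obtain ⟨h, hh⟩ : ∃ h, h = halfPeriod y := ⟨_, rfl⟩
  have key := theta_identity_three_term hy (-b + h / 2) (h / 2) (x + h / 2) (-a + h / 2)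
  rw [show -b + h / 2 + h / 2 = -b + h by ring, show -b + h / 2 - h / 2 = -b by ring,
    show x + h / 2 + (-a + h / 2) = x - a + h by ring,
    show x + h / 2 - (-a + h / 2) = x + a by ring,
    show -a + h / 2 + h / 2 = -a + h by ring, show -a + h / 2 - h / 2 = -a by ring,
    show x + h / 2 + (-b + h / 2) = x - b + h by ring,
    show x + h / 2 - (-b + h / 2) = x + b by ring,
    show -b + h / 2 + (-a + h / 2) = -(a + b) + h by ring,
    show -b + h / 2 - (-a + h / 2) = -(b - a) by ring,
    show x + h / 2 + h / 2 = x + h by ring, show x + h / 2 - h / 2 = x by ring] at key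
  simp only [hh, th1_add_halfPeriod, th2_add_halfPeriod, th3_add_halfPeriod,
    th4_add_halfPeriod, th1_neg, th3_neg] at key
  have e1 := shiftFactor_mul y (-b) (x - a) (-(a + b)) x (by ring)
  have e2 := shiftFactor_mul y (-a) (x - b) (-(a + b)) x (by ring)
  refine mul_left_cancel₀ (mul_ne_zero (shiftFactor_ne_zero y (-(a + b)))
    (shiftFactor_ne_zero y x)) ?_
  linear_combination -key - (th1 y b * th3 y b * (th4 y (x - a) * th2 y (x + a))) * e1
    + (th1 y a * th3 y a * (th4 y (x - b) * th2 y (x + b))) * e2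
    + (shiftFactor y (-b) * shiftFactor y (x - a)
        * (th1 y b * th3 y b * (th4 y (x - a) * th2 y (x + a)))
      - shiftFactor y (-a) * shiftFactor y (x - b)
        * (th1 y a * th3 y a * (th4 y (x - b) * th2 y (x + b)))) * Complex.I_sq

/-! ### Positivity -/

theorem th3_I_mul_pos {y : ℝ} (hy : 0 < y) (w : ℝ) :
    ∃ p : ℝ, 0 < p ∧ th3 y (Complex.I * w) = p := by
  have e : ∀ n : ℤ, Complex.exp (Real.pi * Complex.I * (Complex.I * y) * (n : ℂ) ^ 2
      + 2 * Real.pi * Complex.I * (n : ℂ) * (Complex.I * w))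
      = (Real.exp (-(Real.pi * y * n ^ 2) - 2 * Real.pi * n * w) : ℂ) := fun n => by
    push_cast
    congr 1
    linear_combination (Real.pi * y * n ^ 2 + 2 * Real.pi * n * w : ℂ) * Complex.I_sq
  have hs := summable_th3 hy (Complex.I * w)
  simp only [e, Complex.summable_ofReal] at hs
  refine ⟨_, hs.tsum_pos (fun n => (Real.exp_pos _).le) 0 (Real.exp_pos _), ?_⟩
  rw [th3, theta3, Complex.ofReal_tsum]
  exact tsum_congr e

theorem th3_I_mul_ne_zero {y : ℝ} (hy : 0 < y) (w : ℝ) : th3 y (Complex.I * w) ≠ 0 := by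
  obtain ⟨p, hp, h⟩ := th3_I_mul_pos hy w
  rw [h]
  exact_mod_cast hp.ne'

theorem th2_I_mul_ne_zero {y : ℝ} (hy : 0 < y) (w : ℝ) : th2 y (Complex.I * w) ≠ 0 := by
  rw [th2_eq_th3, show Complex.I * w + Complex.I * y / 2 = Complex.I * (w + y / 2 : ℝ) by
    push_cast; ring]
  exact mul_ne_zero (Complex.exp_ne_zero _) (th3_I_mul_ne_zero hy _)

/-- The new argument is `-ix/y`, so the real and imaginary axes are interchanged; this moves
positivity from one to the other. -/
theorem th3_functional_equation {y : ℝ} (hy : 0 < y) (x : ℂ) :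
    th3 y x = ((Real.sqrt y)⁻¹ : ℝ) * Complex.exp (-(Real.pi * x ^ 2 / y))
      * th3 y⁻¹ (-(Complex.I * x / y)) := by
  have hy0 : (y : ℂ) ≠ 0 := by exact_mod_cast hy.ne'
  rw [th3_eq_jacobiTheta₂, th3_eq_jacobiTheta₂, jacobiTheta₂_functional_equation]
  congr 1
  · congr 1
    · rw [show -Complex.I * (Complex.I * y) = (y : ℂ) by linear_combination (-y : ℂ) * Complex.I_sq,
        Real.sqrt_eq_rpow, Complex.ofReal_inv, Complex.ofReal_cpow hy.le, one_div]
      norm_num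
    · congr 1
      field_simp
  · congr 1
    · field_simp
      linear_combination x * Complex.I_sq
    · push_cast
      field_simp
      linear_combination -Complex.I_sq

theorem th3_ofReal_pos {y : ℝ} (hy : 0 < y) (x : ℝ) : ∃ p : ℝ, 0 < p ∧ th3 y x = p := by
  obtain ⟨p, hp, h⟩ := th3_I_mul_pos (inv_pos.mpr hy) (-(x / y))
  refine ⟨(Real.sqrt y)⁻¹ * Real.exp (-(Real.pi * x ^ 2 / y)) * p, by positivity, ?_⟩
  rw [th3_functional_equation hy, show -(Complex.I * x / y) = Complex.I * (-(x / y) : ℝ) by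
    push_cast; ring, h]
  push_cast
  ring

theorem th3_ofReal_ne_zero {y : ℝ} (hy : 0 < y) (x : ℝ) : th3 y x ≠ 0 := by
  obtain ⟨p, hp, h⟩ := th3_ofReal_pos hy x
  rw [h]
  exact_mod_cast hp.ne'

theorem th4_ofReal_ne_zero {y : ℝ} (hy : 0 < y) (x : ℝ) : th4 y x ≠ 0 := by
  rw [th4_eq_th3, show (x : ℂ) + 1 / 2 = (x + 1 / 2 : ℝ) by push_cast; ring]
  exact th3_ofReal_ne_zero hy _

theorem th3_zero_ne_zero {y : ℝ} (hy : 0 < y) : th3 y 0 ≠ 0 := by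
  simpa using th3_ofReal_ne_zero hy 0

theorem th4_zero_ne_zero {y : ℝ} (hy : 0 < y) : th4 y 0 ≠ 0 := by
  simpa using th4_ofReal_ne_zero hy 0

theorem th2_zero_ne_zero {y : ℝ} (hy : 0 < y) : th2 y 0 ≠ 0 := by
  simpa using th2_I_mul_ne_zero hy 0

/-! ### Zeros on the real and imaginary axes -/

/-- The product formula at equal arguments reads `ϑ₂(x) ϑ₂(0) = 2 ϑ₃(x) ϑ₂(x)` with doubled
parameter on the right, and `ϑ₃` has no real zero. -/
theorem th2_two_mul_eq_zero {y : ℝ} (hy : 0 < y) {x : ℝ} (h : th2 y x = 0) :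
    th2 (2 * y) x = 0 := by
  have key := th2_mul_th2 hy (x / 2) (x / 2)
  rw [add_halves, h, zero_mul, mul_div_cancel₀ _ (two_ne_zero), eq_comm, mul_comm, ← two_mul] at key
  have h3 := th3_ofReal_ne_zero (show 0 < 2 * y by positivity) x
  simpa [h3] using key

theorem th2_two_pow_mul_eq_zero {y : ℝ} (hy : 0 < y) {x : ℝ} (h : th2 y x = 0) (k : ℕ) :
    th2 (2 ^ k * y) x = 0 := by
  induction k with
  | zero => simpa using h
  | succ k ih =>
    rw [pow_succ', mul_assoc]
    exact th2_two_mul_eq_zero (by positivity) ih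

theorem exp_mul_th2_eq_tsum (y x : ℝ) :
    Complex.exp (Real.pi * y / 4) * th2 y x = ∑' n : ℤ,
      (Real.exp (-(Real.pi * y * (n ^ 2 + n))) : ℂ)
        * Complex.exp (2 * Real.pi * Complex.I * (n + 1 / 2) * x) := by
  rw [th2, theta2, ← tsum_mul_left]
  refine tsum_congr fun n => ?_
  rw [Complex.ofReal_exp, ← Complex.exp_add, ← Complex.exp_add]
  congr 1
  push_cast
  linear_combination (Real.pi * y * (n + 1 / 2) ^ 2 : ℂ) * Complex.I_sq

theorem norm_exp_two_pi_I_mul (n x : ℝ) :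
    ‖Complex.exp (2 * Real.pi * Complex.I * (n + 1 / 2) * x)‖ = 1 := by
  rw [show 2 * Real.pi * Complex.I * (n + 1 / 2) * x
    = (2 * Real.pi * (n + 1 / 2) * x : ℝ) * Complex.I by push_cast; ring,
    Complex.norm_exp_ofReal_mul_I]

theorem summable_exp_neg_quadratic {y : ℝ} (hy : 0 < y) :
    Summable fun n : ℤ => Real.exp (-(Real.pi * y * ((n : ℝ) ^ 2 + n))) := by
  have h := ((summable_th2 hy 0).mul_left (Complex.exp (Real.pi * y / 4))).norm
  refine h.congr fun n => ?_
  rw [← Complex.exp_add, show Real.pi * y / 4 + (Real.pi * Complex.I * (Complex.I * y)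
      * ((n : ℂ) + 1 / 2) ^ 2 + 2 * Real.pi * Complex.I * ((n : ℂ) + 1 / 2) * 0)
    = (-(Real.pi * y * ((n : ℝ) ^ 2 + n)) : ℝ) by
      push_cast
      linear_combination (Real.pi * y * (n + 1 / 2) ^ 2 : ℂ) * Complex.I_sq,
    ← Complex.ofReal_exp, Complex.norm_real, Real.norm_of_nonneg (Real.exp_pos _).le]

/-- After normalisation the terms carry `exp (-πy(n² + n))`. Only `n = 0` and `n = -1` survive as
`y` grows, and they sum to the cosine; the series for `k = 0` dominates. -/
theorem tendsto_exp_mul_th2 {y : ℝ} (hy : 0 < y) (x : ℝ) :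
    Tendsto (fun k : ℕ => Complex.exp (Real.pi * (2 ^ k * y : ℝ) / 4) * th2 (2 ^ k * y) x) atTop
      (𝓝 (2 * Complex.cos (Real.pi * x))) := by
  simp only [exp_mul_th2_eq_tsum]
  have hl : 2 * Complex.cos (Real.pi * x) = ∑' n : ℤ, if n ∈ ({0, -1} : Finset ℤ) then
      Complex.exp (2 * Real.pi * Complex.I * (n + 1 / 2) * x) else 0 := by
    rw [tsum_eq_sum (s := ({0, -1} : Finset ℤ)) (fun n hn => if_neg hn), Finset.sum_pair (by simp),
      Complex.two_cos]
    simp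
    congr 2 <;> ring
  rw [hl]
  have hq : ∀ n : ℤ, 0 ≤ (n : ℝ) ^ 2 + n := fun n => by
    have : 0 ≤ n ^ 2 + n := by
      rcases le_or_gt 0 n with h | h <;> nlinarith
    exact_mod_cast this
  refine tendsto_tsum_of_dominated_convergence (summable_exp_neg_quadratic hy) (fun n => ?_)
    (Eventually.of_forall fun k n => ?_)
  · have hT : Tendsto (fun k : ℕ => (2 : ℝ) ^ k * y) atTop atTop :=
      (tendsto_pow_atTop_atTop_of_one_lt one_lt_two).atTop_mul_const hy
    split_ifs with h
    · have h0 : (n : ℝ) ^ 2 + n = 0 := by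
        simp only [Finset.mem_insert, Finset.mem_singleton] at h
        rcases h with rfl | rfl <;> norm_num
      simp [h0]
    · have h0 : 0 < (n : ℝ) ^ 2 + n := by
        refine (hq n).lt_of_ne' fun h0 => h ?_
        have : n * (n + 1) = 0 := by
          have : (n : ℝ) * (n + 1) = 0 := by linear_combination h0
          exact_mod_cast this
        simp only [Finset.mem_insert, Finset.mem_singleton]
        rcases mul_eq_zero.mp this with h | h <;> omega
      rw [← zero_mul (Complex.exp (2 * Real.pi * Complex.I * (n + 1 / 2) * x))]
      refine Tendsto.mul_const _ ?_
      rw [← Complex.ofReal_zero]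
      refine (Complex.continuous_ofReal.tendsto 0).comp (Real.tendsto_exp_neg_atTop_nhds_zero.comp ?_)
      exact (hT.const_mul_atTop Real.pi_pos).atTop_mul_const h0
  · have h1 := norm_exp_two_pi_I_mul n x
    push_cast at h1
    rw [norm_mul, h1, mul_one, Complex.norm_real, Real.norm_of_nonneg (Real.exp_pos _).le,
      Real.exp_le_exp, neg_le_neg_iff]
    have : y ≤ 2 ^ k * y := le_mul_of_one_le_left hy.le (one_le_pow₀ one_le_two)
    have := hq n
    gcongr

/-- A real zero persists under all doublings of `y`, so the limit `2 cos (πx)` vanishes and `x` is a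
half-integer. -/
theorem th2_ofReal_ne_zero {y : ℝ} (hy : 0 < y) {x : ℝ} (hx : ∀ j : ℤ, x ≠ j + 1 / 2) :
    th2 y x ≠ 0 := fun h => by
  have h1 := tendsto_exp_mul_th2 hy x
  simp only [th2_two_pow_mul_eq_zero hy h, mul_zero] at h1
  have h2 := tendsto_nhds_unique h1 tendsto_const_nhds
  rw [mul_eq_zero, or_iff_right two_ne_zero, Complex.cos_eq_zero_iff] at h2
  obtain ⟨k, hk⟩ := h2
  refine hx k ?_
  have h3 : (Real.pi : ℂ) ≠ 0 := by exact_mod_cast Real.pi_ne_zero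
  exact Complex.ofReal_injective (mul_left_cancel₀ h3 (by rw [hk]; push_cast; ring))

theorem th1_ofReal_ne_zero {y : ℝ} (hy : 0 < y) {x : ℝ} (hx : ∀ j : ℤ, x ≠ j) : th1 y x ≠ 0 := by
  rw [th1_eq_th2, neg_ne_zero, show (x : ℂ) + 1 / 2 = (x + 1 / 2 : ℝ) by push_cast; ring]
  exact th2_ofReal_ne_zero hy fun j h => hx j (by linarith)

theorem th3_sub_half_ne_zero {y : ℝ} (hy : 0 < y) {x : ℝ} (hx : ∀ j : ℤ, x ≠ j + 1 / 2) :
    th3 y (x - Complex.I * y / 2) ≠ 0 := by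
  have h := th2_ofReal_ne_zero hy hx
  rw [← th2_neg, th2_eq_th3, ← th3_neg] at h
  rw [show x - Complex.I * y / 2 = -(-x + Complex.I * y / 2) by ring]
  exact right_ne_zero_of_mul h

/-- The half period turns `ϑ₁` into `ϑ₃`, and the functional equation sends the point to a real
number minus `i/(2y)`, where `ϑ₃` with parameter `i/y` is controlled by `ϑ₂` on the real axis. -/
theorem th1_I_mul_ne_zero {y : ℝ} (hy : 0 < y) {v : ℝ} (hv : ∀ j : ℤ, v ≠ y * j) :
    th1 y (Complex.I * v) ≠ 0 := by
  have h0 : (y : ℂ) ≠ 0 := by exact_mod_cast hy.ne'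
  suffices h : th3 y (Complex.I * v + halfPeriod y) ≠ 0 by
    rw [th3_add_halfPeriod] at h
    exact right_ne_zero_of_mul h
  rw [th3_functional_equation hy, show -(Complex.I * (Complex.I * v + halfPeriod y) / y)
    = (v / y + 1 / 2 : ℝ) - Complex.I * (y⁻¹ : ℝ) / 2 by
      rw [halfPeriod]
      push_cast
      field_simp
      linear_combination (-2 * v - y : ℂ) * Complex.I_sq]
  refine mul_ne_zero (mul_ne_zero ?_ (Complex.exp_ne_zero _))
    (th3_sub_half_ne_zero (inv_pos.mpr hy) fun j hj => hv j ?_)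
  · exact_mod_cast (inv_pos.mpr (Real.sqrt_pos.mpr hy)).ne'
  · field_simp at hj
    linarith

theorem th4_I_mul_ne_zero {y : ℝ} (hy : 0 < y) {s : ℝ} (hs : ∀ j : ℤ, s ≠ y * (j + 1 / 2)) :
    th4 y (Complex.I * s) ≠ 0 := by
  have h0 : (y : ℂ) ≠ 0 := by exact_mod_cast hy.ne'
  rw [th4_eq_th3, th3_functional_equation hy, show -(Complex.I * (Complex.I * s + 1 / 2) / y)
    = (s / y : ℝ) - Complex.I * (y⁻¹ : ℝ) / 2 by
      push_cast
      field_simp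
      linear_combination (-2 * s : ℂ) * Complex.I_sq]
  refine mul_ne_zero (mul_ne_zero ?_ (Complex.exp_ne_zero _))
    (th3_sub_half_ne_zero (inv_pos.mpr hy) fun j hj => hs j ?_)
  · exact_mod_cast (inv_pos.mpr (Real.sqrt_pos.mpr hy)).ne'
  · field_simp at hj ⊢
    linarith

/-! ### Addition formulas and zeros off the axes -/

theorem th1_mul_th1_mul_th4_sq {y : ℝ} (hy : 0 < y) (x z : ℂ) :
    th1 y (x + z) * th1 y (x - z) * th4 y 0 ^ 2
      = th1 y x ^ 2 * th4 y z ^ 2 - th4 y x ^ 2 * th1 y z ^ 2 := by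
  have h4 := th4_mul_th4 hy 0 0
  have h1x := th1_mul_th1 hy x 0
  have h4x := th4_mul_th4 hy x 0
  have h1z := th1_mul_th1 hy z 0
  have h4z := th4_mul_th4 hy z 0
  simp only [add_zero, sub_zero, mul_zero, ← sq] at h4 h1x h4x h1z h4z
  rw [th1_mul_th1 hy, h4, h1x, h4x, h1z, h4z]
  ring

theorem th3_mul_th3_mul_th2_sq {y : ℝ} (hy : 0 < y) (x z : ℂ) :
    th3 y (x + z) * th3 y (x - z) * th2 y 0 ^ 2
      = th2 y x ^ 2 * th3 y z ^ 2 + th1 y x ^ 2 * th4 y z ^ 2 := by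
  have h2 := th2_mul_th2 hy 0 0
  have h1x := th1_mul_th1 hy x 0
  have h2x := th2_mul_th2 hy x 0
  have h3z := th3_mul_th3 hy z 0
  have h4z := th4_mul_th4 hy z 0
  simp only [add_zero, sub_zero, mul_zero, ← sq] at h2 h1x h2x h3z h4z
  rw [th3_mul_th3 hy, h2, h1x, h2x, h3z, h4z]
  ring

/-- The duplication identity at `x = 0`. It is used for the Wronskian of `ϑ₁` and `ϑ₃`, and for
excluding `R₁ / R₃ = ±1`. -/
theorem th1_mul_th3_mul_th2_mul_th4 {y : ℝ} (hy : 0 < y) (x z : ℂ) :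
    th1 y (x + z) * th3 y (x - z) * (th2 y 0 * th4 y 0)
      = th1 y x * th3 y x * (th2 y z * th4 y z) + th2 y x * th4 y x * (th1 y z * th3 y z) := by
  have h := theta_identity_duplication hy (-z) x 0
  rw [zero_sub, zero_sub, zero_add, zero_add, neg_neg, th2_neg, th4_neg, th1_neg, th3_neg,
    sub_neg_eq_add, show -z + x = x - z by ring] at h
  linear_combination -h

theorem exists_ofReal_of_conj_eq {z : ℂ} (h : conj z = z) : ∃ p : ℝ, z = p :=
  Complex.conj_eq_iff_real.mp h

theorem exists_th1_I_mul (y s : ℝ) : ∃ p : ℝ, th1 y (Complex.I * s) = Complex.I * p := by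
  obtain ⟨p, hp⟩ := exists_ofReal_of_conj_eq (z := -Complex.I * th1 y (Complex.I * s)) (by
    rw [map_mul, conj_th1, map_mul, map_neg, Complex.conj_I, Complex.conj_ofReal,
      neg_mul Complex.I (s : ℂ), th1_neg]
    ring)
  exact ⟨p, by rw [← hp]; linear_combination th1 y (Complex.I * s) * Complex.I_sq⟩

theorem exists_th4_I_mul (y s : ℝ) : ∃ p : ℝ, th4 y (Complex.I * s) = p :=
  exists_ofReal_of_conj_eq (by
    rw [conj_th4, map_mul, Complex.conj_I, Complex.conj_ofReal, neg_mul, th4_neg])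

theorem exists_th1_ofReal (y r : ℝ) : ∃ p : ℝ, th1 y r = p :=
  exists_ofReal_of_conj_eq (by rw [conj_th1, Complex.conj_ofReal])

theorem exists_th2_ofReal (y r : ℝ) : ∃ p : ℝ, th2 y r = p :=
  exists_ofReal_of_conj_eq (by rw [conj_th2, Complex.conj_ofReal])

theorem exists_th4_ofReal (y r : ℝ) : ∃ p : ℝ, th4 y r = p :=
  exists_ofReal_of_conj_eq (by rw [conj_th4, Complex.conj_ofReal])

/-- `ϑ₁` is imaginary on the imaginary axis, so the difference of squares in the addition formula
becomes a sum of real squares, of which the one with `ϑ₄(r) ϑ₁(is)` is positive. -/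
theorem th1_mul_th1_ne_zero {y : ℝ} (hy : 0 < y) (r : ℝ) {s : ℝ} (hs : ∀ j : ℤ, s ≠ y * j) :
    th1 y (r + Complex.I * s) * th1 y (r - Complex.I * s) ≠ 0 := fun h => by
  have key := th1_mul_th1_mul_th4_sq hy r (Complex.I * s)
  have h1 := th1_I_mul_ne_zero hy hs
  have h4 := th4_ofReal_ne_zero hy r
  obtain ⟨a, ha⟩ := exists_th1_ofReal y r
  obtain ⟨b, hb⟩ := exists_th4_ofReal y r
  obtain ⟨c, hc⟩ := exists_th1_I_mul y s
  obtain ⟨d, hd⟩ := exists_th4_I_mul y s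
  rw [hb, Complex.ofReal_ne_zero] at h4
  have hc0 : c ≠ 0 := by rintro rfl; simp [hc] at h1
  rw [h, ha, hb, hc, hd, zero_mul, mul_pow, Complex.I_sq] at key
  have key' : (0 : ℝ) = a ^ 2 * d ^ 2 + b ^ 2 * c ^ 2 := by
    have : (0 : ℂ) = a ^ 2 * d ^ 2 + b ^ 2 * c ^ 2 := by rw [key]; ring
    exact_mod_cast this
  have : 0 < a ^ 2 * d ^ 2 + b ^ 2 * c ^ 2 := by positivity
  linarith

theorem th3_mul_th3_ne_zero {y : ℝ} (hy : 0 < y) {r : ℝ} (s : ℝ) (hr : ∀ j : ℤ, r ≠ j + 1 / 2) :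
    th3 y (r + Complex.I * s) * th3 y (r - Complex.I * s) ≠ 0 := fun h => by
  have key := th3_mul_th3_mul_th2_sq hy r (Complex.I * s)
  have h2 := th2_ofReal_ne_zero hy hr
  obtain ⟨a, ha⟩ := exists_th1_ofReal y r
  obtain ⟨b, hb⟩ := exists_th2_ofReal y r
  obtain ⟨c, hc, hc'⟩ := th3_I_mul_pos hy s
  obtain ⟨d, hd⟩ := exists_th4_I_mul y s
  rw [hb, Complex.ofReal_ne_zero] at h2
  rw [h, ha, hb, hc', hd, zero_mul] at key
  have key' : (0 : ℝ) = b ^ 2 * c ^ 2 + a ^ 2 * d ^ 2 := by exact_mod_cast key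
  have : 0 < b ^ 2 * c ^ 2 + a ^ 2 * d ^ 2 := by positivity
  linarith

/-! ### Derivatives -/

theorem hasDerivAt_th1 {y : ℝ} (hy : 0 < y) (x : ℂ) : HasDerivAt (th1 y) (deriv (th1 y) x) x :=
  (differentiable_th1 hy x).hasDerivAt

theorem hasDerivAt_th2 {y : ℝ} (hy : 0 < y) (x : ℂ) : HasDerivAt (th2 y) (deriv (th2 y) x) x :=
  (differentiable_th2 hy x).hasDerivAt

theorem hasDerivAt_th3 {y : ℝ} (hy : 0 < y) (x : ℂ) : HasDerivAt (th3 y) (deriv (th3 y) x) x :=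
  (differentiable_th3 hy x).hasDerivAt

/-- The part of the mixed addition formula that is odd in `z`, differentiated at `z = 0`. -/
theorem th1_th3_wronskian {y : ℝ} (hy : 0 < y) (x : ℂ) :
    (deriv (th1 y) x * th3 y x - th1 y x * deriv (th3 y) x) * (th2 y 0 * th4 y 0)
      = th2 y x * th4 y x * (deriv (th1 y) 0 * th3 y 0) := by
  have e : (fun z => (th1 y (x + z) * th3 y (x - z) - th1 y (x - z) * th3 y (x + z))
      * (th2 y 0 * th4 y 0)) = fun z => 2 * (th2 y x * th4 y x) * (th1 y z * th3 y z) := by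
    funext z
    have h1 := th1_mul_th3_mul_th2_mul_th4 hy x z
    have h2 := th1_mul_th3_mul_th2_mul_th4 hy x (-z)
    rw [sub_neg_eq_add, ← sub_eq_add_neg, th1_neg, th2_neg, th3_neg, th4_neg] at h2
    linear_combination h1 - h2
  have a1 : HasDerivAt (fun z => th1 y (x + z)) (deriv (th1 y) x) 0 :=
    HasDerivAt.comp_const_add x 0 (by simpa using hasDerivAt_th1 hy x)
  have a3 : HasDerivAt (fun z => th3 y (x + z)) (deriv (th3 y) x) 0 :=
    HasDerivAt.comp_const_add x 0 (by simpa using hasDerivAt_th3 hy x)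
  have b1 : HasDerivAt (fun z => th1 y (x - z)) (-deriv (th1 y) x) 0 :=
    HasDerivAt.comp_const_sub x 0 (by simpa using hasDerivAt_th1 hy x)
  have b3 : HasDerivAt (fun z => th3 y (x - z)) (-deriv (th3 y) x) 0 :=
    HasDerivAt.comp_const_sub x 0 (by simpa using hasDerivAt_th3 hy x)
  have l := ((a1.mul b3).sub (b1.mul a3)).mul_const (th2 y 0 * th4 y 0)
  have r := ((hasDerivAt_th1 hy 0).mul (hasDerivAt_th3 hy 0)).const_mul
    (2 * (th2 y x * th4 y x))
  have := l.unique (e ▸ r)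
  simp only [add_zero, sub_zero, th1_zero] at this
  linear_combination this / 2

/-- Otherwise the Wronskian vanishes and `ϑ₁ / ϑ₃` is constant on the real line, although it is zero
at `0` and nonzero at `1/2`. -/
theorem deriv_th1_zero_ne_zero {y : ℝ} (hy : 0 < y) : deriv (th1 y) 0 ≠ 0 := fun h => by
  have hc : ∀ x : ℝ, HasDerivAt (fun x : ℝ => th1 y x / th3 y x) 0 x := fun x => by
    have h3 := th3_ofReal_ne_zero hy x
    have := ((hasDerivAt_th1 hy x).div (hasDerivAt_th3 hy x) h3).comp_ofReal
    have w := th1_th3_wronskian hy x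
    rw [h, zero_mul, mul_zero, mul_eq_zero,
      or_iff_left (mul_ne_zero (th2_zero_ne_zero hy) (th4_zero_ne_zero hy))] at w
    rwa [w, zero_div] at this
  have h1 := is_const_of_deriv_eq_zero (fun x => (hc x).differentiableAt) (fun x => (hc x).deriv)
    (1 / 2) 0
  have h2 : th1 y (1 / 2 : ℝ) ≠ 0 := th1_ofReal_ne_zero hy fun j hj => by
    have : (1 : ℝ) = 2 * j := by linarith
    have : (1 : ℤ) = 2 * j := by exact_mod_cast this
    omega
  simp only [Complex.ofReal_zero, th1_zero, zero_div, div_eq_zero_iff] at h1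
  exact h1.elim h2 (th3_ofReal_ne_zero hy _)

theorem theta_identity_norm_deriv {y : ℝ} (hy : 0 < y) (r s x : ℂ) :
    (th3 y (r - s) * deriv (th3 y) (r + s) - deriv (th3 y) (r - s) * th3 y (r + s))
        * (th2 y (x + r) * th2 y (x - r))
      + (th1 y (r - s) * deriv (th1 y) (r + s) - deriv (th1 y) (r - s) * th1 y (r + s))
        * (th4 y (x + r) * th4 y (x - r))
    = th3 y (2 * r) * th3 y 0
      * (deriv (th2 y) (x + s) * th2 y (x - s) - th2 y (x + s) * deriv (th2 y) (x - s)) := by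
  have e : (fun s => th3 y (r - s) * th3 y (r + s) * (th2 y (x + r) * th2 y (x - r))
      + th1 y (r - s) * th1 y (r + s) * (th4 y (x + r) * th4 y (x - r)))
      = fun s => th3 y (2 * r) * th3 y 0 * (th2 y (x + s) * th2 y (x - s)) :=
    funext fun s => theta_identity_norm hy r s x
  have a1 := HasDerivAt.comp_const_add r s (hasDerivAt_th1 hy (r + s))
  have a3 := HasDerivAt.comp_const_add r s (hasDerivAt_th3 hy (r + s))
  have a2 := HasDerivAt.comp_const_add x s (hasDerivAt_th2 hy (x + s))
  have b1 := HasDerivAt.comp_const_sub r s (hasDerivAt_th1 hy (r - s))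
  have b3 := HasDerivAt.comp_const_sub r s (hasDerivAt_th3 hy (r - s))
  have b2 := HasDerivAt.comp_const_sub x s (hasDerivAt_th2 hy (x - s))
  have l := ((b3.mul a3).mul_const (th2 y (x + r) * th2 y (x - r))).add
    ((b1.mul a1).mul_const (th4 y (x + r) * th4 y (x - r)))
  have r := (a2.mul b2).const_mul (th3 y (2 * r) * th3 y 0)
  have := l.unique (e ▸ r)
  linear_combination this

/-! ### The constants of the construction -/

theorem pp_eq (v r : ℝ) : pp v r = r + Complex.I * (v / 2 : ℝ) := by
  rw [pp]; push_cast; ring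

theorem pm_eq (v r : ℝ) : pm v r = r - Complex.I * (v / 2 : ℝ) := by
  rw [pm]; push_cast; ring

theorem conj_pm (v r : ℝ) : conj (pm v r) = pp v r := by
  rw [pm_eq, pp_eq]
  simp only [map_sub, map_mul, Complex.conj_ofReal, Complex.conj_I]
  ring

theorem conj_pp (v r : ℝ) : conj (pp v r) = pm v r := by
  rw [← conj_pm, Complex.conj_conj]

theorem conj_deriv_of_conj {h : ℂ → ℂ} (hh : ∀ x, conj (h x) = h (conj x)) (x : ℂ) :
    conj (deriv h x) = deriv h (conj x) := by
  have e : conj ∘ h ∘ conj = h := funext fun x => by simp [hh]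
  have h1 := congrFun (deriv_conj_conj (f := h)) (conj x)
  rw [e] at h1
  rw [h1]
  simp

theorem conj_d1 (y : ℝ) (x : ℂ) : conj (d1 y x) = d1 y (conj x) := by
  rw [d1, map_div₀, conj_th1, conj_deriv_of_conj (conj_th1 y), d1]

theorem conj_d3 (y : ℝ) (x : ℂ) : conj (d3 y x) = d3 y (conj x) := by
  rw [d3, map_div₀, conj_th3, conj_deriv_of_conj (conj_th3 y), d3]

theorem conj_Delta1 (v r y : ℝ) : conj (Delta1 v r y) = -Delta1 v r y := by
  rw [Delta1, map_sub, conj_d1, conj_d1, conj_pm, conj_pp, neg_sub]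

theorem conj_Delta3 (v r y : ℝ) : conj (Delta3 v r y) = -Delta3 v r y := by
  rw [Delta3, map_sub, conj_d3, conj_d3, conj_pm, conj_pp, neg_sub]

theorem conj_R1 (v r y : ℝ) : conj (R1 v r y) = (R1 v r y)⁻¹ := by
  rw [R1, map_div₀, conj_th1, conj_th1, conj_pm, conj_pp, inv_div]

theorem conj_R3 (v r y : ℝ) : conj (R3 v r y) = (R3 v r y)⁻¹ := by
  rw [R3, map_div₀, conj_th3, conj_th3, conj_pm, conj_pp, inv_div]

theorem exists_alpha2 {y : ℝ} (hy : 0 < y) (r : ℝ) : ∃ p : ℝ, 0 < p ∧ alpha2 r y = p := by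
  obtain ⟨p, hp, h⟩ := th3_ofReal_pos hy (2 * r)
  obtain ⟨q, hq, h'⟩ := th3_ofReal_pos hy 0
  push_cast at h h'
  refine ⟨(p * q) ^ (1 / 2 : ℝ), by positivity, ?_⟩
  rw [alpha2, h, h', Complex.ofReal_cpow (by positivity)]
  push_cast
  rfl

theorem alpha2_ne_zero {y : ℝ} (hy : 0 < y) (r : ℝ) : alpha2 r y ≠ 0 := by
  obtain ⟨p, hp, h⟩ := exists_alpha2 hy r
  rw [h]
  exact_mod_cast hp.ne'

theorem conj_alpha2 {y : ℝ} (hy : 0 < y) (r : ℝ) : conj (alpha2 r y) = alpha2 r y := by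
  obtain ⟨p, hp, h⟩ := exists_alpha2 hy r
  rw [h, Complex.conj_ofReal]

theorem alpha2_sq (r y : ℝ) : alpha2 r y ^ 2 = th3 y (2 * r) * th3 y 0 := by
  rw [alpha2, one_div]
  exact Complex.cpow_ofNat_inv_pow _ 2

theorem beta_ne_zero {y : ℝ} (hy : 0 < y) (v : ℝ) : beta v y ≠ 0 :=
  div_ne_zero (th3_I_mul_ne_zero hy v) (th3_zero_ne_zero hy)

theorem beta_im {y : ℝ} (hy : 0 < y) (v : ℝ) : (beta v y).im = 0 := by
  obtain ⟨p, hp, h⟩ := th3_I_mul_pos hy v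
  obtain ⟨q, hq, h'⟩ := th3_ofReal_pos hy 0
  rw [Complex.ofReal_zero] at h'
  rw [beta, h, h', ← Complex.ofReal_div, Complex.ofReal_im]

section Generic

variable {v r y : ℝ}

theorem th1_pp_mul_th1_pm_ne_zero (hy : 0 < y) (hv : ∀ j : ℤ, v ≠ y * (j : ℝ)) :
    th1 y (pp v r) * th1 y (pm v r) ≠ 0 := by
  rw [pp_eq, pm_eq]
  refine th1_mul_th1_ne_zero hy r fun j hj => hv (2 * j) ?_
  push_cast
  linarith

theorem th3_pp_mul_th3_pm_ne_zero (hy : 0 < y) (hr : ∀ j : ℤ, r ≠ 1 / 2 * (j : ℝ)) :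
    th3 y (pp v r) * th3 y (pm v r) ≠ 0 := by
  rw [pp_eq, pm_eq]
  refine th3_mul_th3_ne_zero hy _ fun j hj => hr (2 * j + 1) ?_
  push_cast
  linarith

theorem s2_ne_zero (hy : 0 < y) (hv : ∀ j : ℤ, v ≠ y * (j : ℝ)) : s2 v r y ≠ 0 := by
  refine mul_ne_zero ?_ (th1_I_mul_ne_zero hy hv)
  exact_mod_cast th3_ofReal_ne_zero hy (2 * r)

theorem u2_ne_zero (hy : 0 < y) (hr : ∀ j : ℤ, r ≠ 1 / 2 * (j : ℝ))
    (hv : ∀ j : ℤ, v ≠ y * (j : ℝ)) : u2 v r y ≠ 0 := by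
  have h1 := th1_pp_mul_th1_pm_ne_zero (r := r) hy hv
  have h3 := th3_pp_mul_th3_pm_ne_zero (v := v) hy hr
  rw [u2]
  simp only [mul_ne_zero_iff] at h1 h3 ⊢
  tauto

/-- The Wronskian formula at `a` and at `b` reduces the two logarithmic derivatives of `ϑ₁ / ϑ₃` to
products `ϑ₂ ϑ₄`; the duplication identity at `x = 0` combines these. -/
theorem Delta3_sub_Delta1_mul_u2 (hy : 0 < y) (hr : ∀ j : ℤ, r ≠ 1 / 2 * (j : ℝ))
    (hv : ∀ j : ℤ, v ≠ y * (j : ℝ)) :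
    (Delta3 v r y - Delta1 v r y) * u2 v r y = -(deriv (th1 y) 0 * th3 y 0 * s2 v r y) := by
  obtain ⟨h1p, h1m⟩ := mul_ne_zero_iff.mp (th1_pp_mul_th1_pm_ne_zero (r := r) hy hv)
  obtain ⟨h3p, h3m⟩ := mul_ne_zero_iff.mp (th3_pp_mul_th3_pm_ne_zero (v := v) hy hr)
  have wm := th1_th3_wronskian hy (pm v r)
  have wp := th1_th3_wronskian hy (pp v r)
  have hd := theta_identity_duplication hy (pm v r) (pp v r) 0
  rw [zero_sub, zero_sub, zero_add, zero_add, th4_neg, th4_neg,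
    show pm v r + pp v r = 2 * r by rw [pm_eq, pp_eq]; ring,
    show pp v r - pm v r = Complex.I * v by rw [pm, pp]; ring] at hd
  refine mul_right_cancel₀ (mul_ne_zero (th2_zero_ne_zero hy) (th4_zero_ne_zero hy)) ?_
  rw [Delta3, Delta1, d3, d3, d1, d1, u2, s2]
  field_simp
  linear_combination -th1 y (pp v r) * th3 y (pp v r) * wm + th1 y (pm v r) * th3 y (pm v r) * wp
    - deriv (th1 y) 0 * th3 y 0 * hd

theorem Delta3_sub_Delta1_ne_zero (hy : 0 < y) (hr : ∀ j : ℤ, r ≠ 1 / 2 * (j : ℝ))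
    (hv : ∀ j : ℤ, v ≠ y * (j : ℝ)) : Delta3 v r y - Delta1 v r y ≠ 0 := by
  refine left_ne_zero_of_mul (b := u2 v r y) ?_
  rw [Delta3_sub_Delta1_mul_u2 hy hr hv]
  exact neg_ne_zero.mpr (mul_ne_zero (mul_ne_zero (deriv_th1_zero_ne_zero hy)
    (th3_zero_ne_zero hy)) (s2_ne_zero hy hv))

/-! ### The torsion angle -/

theorem R1_ne_zero (hy : 0 < y) (hv : ∀ j : ℤ, v ≠ y * (j : ℝ)) : R1 v r y ≠ 0 := by
  obtain ⟨h1p, h1m⟩ := mul_ne_zero_iff.mp (th1_pp_mul_th1_pm_ne_zero (r := r) hy hv)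
  exact div_ne_zero h1m h1p

theorem R3_ne_zero (hy : 0 < y) (hr : ∀ j : ℤ, r ≠ 1 / 2 * (j : ℝ)) : R3 v r y ≠ 0 := by
  obtain ⟨h3p, h3m⟩ := mul_ne_zero_iff.mp (th3_pp_mul_th3_pm_ne_zero (v := v) hy hr)
  exact div_ne_zero h3m h3p

theorem norm_R1_mul_R3_inv (hy : 0 < y) (hr : ∀ j : ℤ, r ≠ 1 / 2 * (j : ℝ))
    (hv : ∀ j : ℤ, v ≠ y * (j : ℝ)) : ‖R1 v r y * (R3 v r y)⁻¹‖ = 1 := by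
  have h : conj (R1 v r y * (R3 v r y)⁻¹) * (R1 v r y * (R3 v r y)⁻¹) = 1 := by
    have h1 := R1_ne_zero (r := r) hy hv
    have h3 := R3_ne_zero (v := v) hy hr
    rw [map_mul, map_inv₀, conj_R1, conj_R3]
    field_simp
  rw [Complex.conj_mul'] at h
  have h' : ‖R1 v r y * (R3 v r y)⁻¹‖ ^ 2 = 1 := by exact_mod_cast h
  exact (pow_eq_one_iff_of_nonneg (norm_nonneg _) two_ne_zero).mp h'

/-- By the mixed addition formula at `z = ±iv/2`, the sum and the difference of `ϑ₁(a) ϑ₃(b)` and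
`ϑ₁(b) ϑ₃(a)` are, up to nonzero constants, `ϑ₁ϑ₃(r) ϑ₂ϑ₄(iv/2)` and `ϑ₂ϑ₄(r) ϑ₁ϑ₃(iv/2)`. The
genericity of `r` and `v` makes both nonzero. -/
theorem R1_mul_R3_inv_sq_ne_one (hy : 0 < y) (hr : ∀ j : ℤ, r ≠ 1 / 2 * (j : ℝ))
    (hv : ∀ j : ℤ, v ≠ y * (j : ℝ)) :
    R1 v r y * (R3 v r y)⁻¹ ≠ 1 ∧ R1 v r y * (R3 v r y)⁻¹ ≠ -1 := by
  obtain ⟨h1p, h1m⟩ := mul_ne_zero_iff.mp (th1_pp_mul_th1_pm_ne_zero (r := r) hy hv)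
  obtain ⟨h3p, h3m⟩ := mul_ne_zero_iff.mp (th3_pp_mul_th3_pm_ne_zero (v := v) hy hr)
  have ep := th1_mul_th3_mul_th2_mul_th4 hy r (Complex.I * (v / 2 : ℝ))
  have em := th1_mul_th3_mul_th2_mul_th4 hy r (-(Complex.I * (v / 2 : ℝ)))
  rw [sub_neg_eq_add, ← sub_eq_add_neg, th1_neg, th2_neg, th3_neg, th4_neg, ← pp_eq,
    ← pm_eq] at em
  rw [← pp_eq, ← pm_eq] at ep
  have n1r : th1 y r ≠ 0 := th1_ofReal_ne_zero hy fun j hj => hr (2 * j) (by push_cast; linarith)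
  have n2r : th2 y r ≠ 0 := th2_ofReal_ne_zero hy fun j hj => hr (2 * j + 1) (by push_cast; linarith)
  have n3r := th3_ofReal_ne_zero hy r
  have n4r := th4_ofReal_ne_zero hy r
  have n1s : th1 y (Complex.I * (v / 2 : ℝ)) ≠ 0 :=
    th1_I_mul_ne_zero hy fun j hj => hv (2 * j) (by push_cast; linarith)
  have n2s := th2_I_mul_ne_zero hy (v / 2)
  have n3s := th3_I_mul_ne_zero hy (v / 2)
  have n4s : th4 y (Complex.I * (v / 2 : ℝ)) ≠ 0 :=
    th4_I_mul_ne_zero hy fun j hj => hv (2 * j + 1) (by push_cast; linarith)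
  constructor <;> intro h <;> rw [R1, R3] at h <;> field_simp at h
  · refine mul_ne_zero (mul_ne_zero n2r n4r) (mul_ne_zero n1s n3s) ?_
    linear_combination (em - ep - h * (th2 y 0 * th4 y 0)) / 2
  · refine mul_ne_zero (mul_ne_zero n1r n3r) (mul_ne_zero n2s n4s) ?_
    linear_combination (-em - ep + h * (th2 y 0 * th4 y 0)) / 2

theorem lam_eq_arg (v r y : ℝ) : lam v r y = (R1 v r y * (R3 v r y)⁻¹).arg := by
  rw [lam, ← Complex.log_im, one_div, Complex.inv_I]
  simp

theorem ofReal_lam (hy : 0 < y) (hr : ∀ j : ℤ, r ≠ 1 / 2 * (j : ℝ))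
    (hv : ∀ j : ℤ, v ≠ y * (j : ℝ)) :
    (lam v r y : ℂ) = 1 / Complex.I * Complex.log (R1 v r y * (R3 v r y)⁻¹) := by
  rw [lam_eq_arg, Complex.log, norm_R1_mul_R3_inv hy hr hv, Real.log_one, one_div, Complex.inv_I]
  push_cast
  linear_combination ((R1 v r y * (R3 v r y)⁻¹).arg : ℂ) * Complex.I_sq

theorem exp_lam_mul_I (hy : 0 < y) (hr : ∀ j : ℤ, r ≠ 1 / 2 * (j : ℝ))
    (hv : ∀ j : ℤ, v ≠ y * (j : ℝ)) :
    Complex.exp (lam v r y * Complex.I) = R1 v r y * (R3 v r y)⁻¹ := by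
  have h := Complex.norm_mul_exp_arg_mul_I (R1 v r y * (R3 v r y)⁻¹)
  rwa [norm_R1_mul_R3_inv hy hr hv, Complex.ofReal_one, one_mul, ← lam_eq_arg] at h

theorem lam_range (hy : 0 < y) (hr : ∀ j : ℤ, r ≠ 1 / 2 * (j : ℝ))
    (hv : ∀ j : ℤ, v ≠ y * (j : ℝ)) :
    -Real.pi < lam v r y ∧ lam v r y < Real.pi ∧ lam v r y ≠ 0 := by
  have he := exp_lam_mul_I hy hr hv
  obtain ⟨h1, h2⟩ := R1_mul_R3_inv_sq_ne_one hy hr hv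
  rw [← he] at h1 h2
  have hl := lam_eq_arg v r y
  refine ⟨hl ▸ Complex.neg_pi_lt_arg _, lt_of_le_of_ne (hl ▸ Complex.arg_le_pi _) ?_, ?_⟩
  · intro h
    rw [h] at h2
    exact h2 Complex.exp_pi_mul_I
  · intro h
    rw [h] at h1
    simp at h1

end Generic

/-! ### The bilinear equations -/

theorem ex_ne_zero (v r y C Γ t : ℝ) (a c z : ℂ) : ex v r y C Γ t a c z ≠ 0 := Complex.exp_ne_zero _

/-- A product of exponentials depends only on the total weights, and these agree across each
bilinear equation. -/
theorem ex_mul_ex (v r y C Γ t : ℝ) {a b c d a' b' c' d' : ℂ} (h : a + b = a' + b')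
    (h' : c + d = c' + d') (z : ℂ) :
    ex v r y C Γ t a c z * ex v r y C Γ t b d z
      = ex v r y C Γ t a' c' z * ex v r y C Γ t b' d' z := by
  rw [ex, ex, ex, ex, ← Complex.exp_add, ← Complex.exp_add]
  congr 1
  linear_combination Delta3 v r y / (Delta3 v r y - Delta1 v r y) * z * h
    + Γ * Complex.I * t * h'

/-- `Δ₁` and `Δ₃` are imaginary, so `Δ₃ / (Δ₃ - Δ₁)` is real and only the weight of `Γ` changes
sign. -/
theorem conj_ex_conj (v r y C Γ t : ℝ) {a c : ℂ} (ha : conj a = a) (hc : conj c = c) (z : ℂ) :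
    conj (ex v r y C Γ t a c (conj z)) = ex v r y C Γ t a (-c) z := by
  rw [ex, ex, ← Complex.exp_conj]
  congr 1
  simp only [map_add, map_mul, map_div₀, map_sub, Complex.conj_ofReal, Complex.conj_I, ha, hc,
    conj_Delta1, conj_Delta3, Complex.conj_conj, Complex.conj_ofNat]
  rw [show -Delta3 v r y - -Delta1 v r y = -(Delta3 v r y - Delta1 v r y) by ring, mul_neg,
    neg_div_neg_eq]
  ring

theorem conj_mu_conj (v r y : ℝ) (n : ℤ) (z : ℂ) : conj (mu v r y n (conj z)) = -mu v r y n z := by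
  simp only [mu, map_add, map_mul, map_div₀, map_sub, Complex.conj_ofReal, Complex.conj_I,
    conj_Delta1, conj_Delta3, Complex.conj_conj, map_intCast]
  rw [show -Delta3 v r y - -Delta1 v r y = -(Delta3 v r y - Delta1 v r y) by ring, div_neg]
  ring

theorem mu_add_one (v r y : ℝ) (n : ℤ) (z : ℂ) :
    mu v r y (n + 1) z = mu v r y n z + Complex.I * v := by
  rw [mu, mu]
  push_cast
  ring

theorem mu_sub_one (v r y : ℝ) (n : ℤ) (z : ℂ) :
    mu v r y (n - 1) z = mu v r y n z - Complex.I * v := by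
  rw [mu, mu]
  push_cast
  ring

section ThetaTau

variable {v r y : ℝ} (C Γ t : ℝ)

theorem st_thetaTau_F (hy : 0 < y) (n : ℤ) :
    st ((thetaTau v r y C Γ t).F n) = (thetaTau v r y C Γ t).F n := by
  funext z
  simp only [st, thetaTau, map_mul, conj_th2, conj_alpha2 hy, map_add, map_sub, conj_mu_conj,
    map_div₀, map_one, Complex.conj_ofReal, Complex.conj_I, Complex.conj_ofNat]
  rw [conj_ex_conj _ _ _ _ _ _ (map_intCast _ n) (map_zero _), neg_zero, ← th2_neg]
  congr 2
  ring

theorem st_thetaTau_Gt (hy : 0 < y) (n : ℤ) :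
    st ((thetaTau v r y C Γ t).Gt n) = (thetaTau v r y C Γ t).Gt n := by
  funext z
  simp only [st, thetaTau, map_mul, map_neg, conj_th1, conj_th3, conj_th4, conj_alpha2 hy, map_add,
    map_sub, conj_mu_conj, map_div₀, map_one, map_zero, Complex.conj_ofReal, Complex.conj_I,
    Complex.conj_ofNat]
  rw [conj_ex_conj _ _ _ _ _ _ (map_intCast _ n) (map_zero _), neg_zero, ← th4_neg,
    show -Complex.I * (v : ℂ) = -(Complex.I * v) by ring, th1_neg, show
    -(-mu v r y n z - 1 / 2 * -Complex.I * v + -Complex.I * t)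
      = mu v r y n z - 1 / 2 * Complex.I * v + Complex.I * t by ring]
  ring

theorem st_thetaTau_G (hy : 0 < y) (n : ℤ) (z : ℂ) :
    st ((thetaTau v r y C Γ t).G n) z = -alpha2 r y * (th1 y (Complex.I * v) / th3 y 0)
      * R1 v r y ^ n * R3 v r y ^ (-n) * ex v r y C Γ t n 0 z
      * th4 y (mu v r y n z - 1 / 2 * Complex.I * v + Complex.I * t) := by
  simp only [st, thetaTau, map_mul, conj_th1, conj_th3, conj_th4, conj_alpha2 hy, map_add,
    map_sub, conj_mu_conj, map_div₀, map_one, map_zero, map_zpow₀, conj_R1, conj_R3,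
    Complex.conj_ofReal, Complex.conj_I, Complex.conj_ofNat, inv_zpow', neg_neg]
  rw [conj_ex_conj _ _ _ _ _ _ (map_intCast _ n) (map_zero _), neg_zero, ← th4_neg,
    show -Complex.I * (v : ℂ) = -(Complex.I * v) by ring, th1_neg, show
    -(-mu v r y n z - 1 / 2 * -Complex.I * v + -Complex.I * t)
      = mu v r y n z - 1 / 2 * Complex.I * v + Complex.I * t by ring]
  ring

theorem conj_intCast_add_half (n : ℤ) : conj ((n : ℂ) + 1 / 2) = (n : ℂ) + 1 / 2 := by
  simp [Complex.conj_ofNat]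

theorem st_thetaTau_f (n : ℤ) (z : ℂ) :
    st ((thetaTau v r y C Γ t).f n) z = th3 y (pp v r)
      * R3 v r y ^ (-n) * ex v r y C Γ t (n + 1 / 2) (1 / 2) z
      * th2 y (mu v r y n z - r + Complex.I * t) := by
  simp only [st, thetaTau, map_mul, conj_th2, conj_th3, conj_pm, map_add, conj_mu_conj, map_zpow₀,
    conj_R3, Complex.conj_ofReal, Complex.conj_I, inv_zpow']
  rw [conj_ex_conj _ _ _ _ _ _ (conj_intCast_add_half n) (by simp [Complex.conj_ofNat]), neg_neg,
    ← th2_neg]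
  congr 2
  ring

theorem st_thetaTau_g (n : ℤ) (z : ℂ) :
    st ((thetaTau v r y C Γ t).g n) z = th1 y (pm v r)
      * R1 v r y ^ n * ex v r y C Γ t (n + 1 / 2) (-(1 / 2)) z
      * th4 y (mu v r y n z + r + Complex.I * t) := by
  simp only [st, thetaTau, map_mul, conj_th4, conj_th1, conj_pp, map_add, map_sub, conj_mu_conj,
    map_zpow₀, conj_R1, Complex.conj_ofReal, Complex.conj_I, inv_zpow', neg_neg]
  rw [conj_ex_conj _ _ _ _ _ _ (conj_intCast_add_half n) (by simp [Complex.conj_ofNat]),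
    ← th4_neg]
  congr 2
  ring

theorem im_eq_zero_of_st_eq {h : ℂ → ℂ} (hh : st h = h) (x : ℝ) : (h x).im = 0 := by
  have := congrFun hh x
  rw [st, Complex.conj_ofReal] at this
  exact Complex.conj_eq_iff_im.mp this

theorem bilinear_norm (hy : 0 < y) (hr : ∀ j : ℤ, r ≠ 1 / 2 * (j : ℝ))
    (hv : ∀ j : ℤ, v ≠ y * (j : ℝ)) (n : ℤ) (z : ℂ) :
    (thetaTau v r y C Γ t).f n z * st ((thetaTau v r y C Γ t).f n) z
      + (thetaTau v r y C Γ t).g n z * st ((thetaTau v r y C Γ t).g n) z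
    = (thetaTau v r y C Γ t).F (n + 1) z * (thetaTau v r y C Γ t).F n z := by
  rw [st_thetaTau_f, st_thetaTau_g]
  simp only [thetaTau, mu_add_one]
  have key := theta_identity_norm hy r (1 / 2 * Complex.I * v) (mu v r y n z + Complex.I * t)
  have ha := alpha2_sq r y
  have e1 := ex_mul_ex v r y C Γ t (a := n + 1 / 2) (b := n + 1 / 2) (c := -(1 / 2)) (d := 1 / 2)
    (a' := (n + 1 : ℤ)) (b' := n) (c' := 0) (d' := 0) (by push_cast; ring) (by ring) z
  have h3 := mul_inv_cancel₀ (zpow_ne_zero n (R3_ne_zero (v := v) hy hr))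
  have h1 := mul_inv_cancel₀ (zpow_ne_zero n (R1_ne_zero (r := r) hy hv))
  rw [show mu v r y n z + Complex.I * v - 1 / 2 * Complex.I * v + Complex.I * t
      = mu v r y n z + Complex.I * t + 1 / 2 * Complex.I * v by ring,
    show mu v r y n z - 1 / 2 * Complex.I * v + Complex.I * t
      = mu v r y n z + Complex.I * t - 1 / 2 * Complex.I * v by ring,
    show mu v r y n z + r + Complex.I * t = mu v r y n z + Complex.I * t + r by ring,
    show mu v r y n z - r + Complex.I * t = mu v r y n z + Complex.I * t - r by ring,
    zpow_neg, zpow_neg]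
  rw [← ha, show (r : ℂ) - 1 / 2 * Complex.I * v = pm v r by rw [pm]; ring,
    show (r : ℂ) + 1 / 2 * Complex.I * v = pp v r by rw [pp]; ring] at key
  generalize mu v r y n z + Complex.I * t = X at *
  linear_combination ex v r y C Γ t (n + 1 / 2) (-(1 / 2)) z * ex v r y C Γ t (n + 1 / 2) (1 / 2) z
      * key + alpha2 r y ^ 2 * (th2 y (X + 1 / 2 * Complex.I * v)
        * th2 y (X - 1 / 2 * Complex.I * v)) * e1
    + ex v r y C Γ t (n + 1 / 2) (-(1 / 2)) z * ex v r y C Γ t (n + 1 / 2) (1 / 2) z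
      * (th3 y (pm v r) * th3 y (pp v r) * (th2 y (X + r) * th2 y (X - r)) * h3
        + th1 y (pm v r) * th1 y (pp v r) * (th4 y (X + r) * th4 y (X - r)) * h1)

theorem bilinear_transfer_even (hy : 0 < y) (hr : ∀ j : ℤ, r ≠ 1 / 2 * (j : ℝ))
    (hv : ∀ j : ℤ, v ≠ y * (j : ℝ)) (n : ℤ) (z : ℂ) :
    beta v y * (thetaTau v r y C Γ t).F n z * (thetaTau v r y C Γ t).f n z
      + (thetaTau v r y C Γ t).G n z * st ((thetaTau v r y C Γ t).g n) z
    = (thetaTau v r y C Γ t).F (n + 1) z * (thetaTau v r y C Γ t).f (n - 1) z := by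
  rw [st_thetaTau_g]
  simp only [thetaTau, mu_add_one, mu_sub_one]
  have key := theta_identity_transfer_even hy r (1 / 2 * Complex.I * v)
    (mu v r y n z + Complex.I * t)
  have e1 := ex_mul_ex v r y C Γ t (a := n) (b := n + 1 / 2) (c := 0) (d := -(1 / 2))
    (a' := (n + 1 : ℤ)) (b' := (n - 1 : ℤ) + 1 / 2) (c' := 0) (d' := -(1 / 2))
    (by push_cast; ring) (by ring) z
  have h1 := mul_inv_cancel₀ (zpow_ne_zero n (R1_ne_zero (r := r) hy hv))
  obtain ⟨h3p, h3m⟩ := mul_ne_zero_iff.mp (th3_pp_mul_th3_pm_ne_zero (v := v) hy hr)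
  -- One power of `R₃` trades `ϑ₃(a)` for `ϑ₃(b)`; the prefactor of `f_{n-1}` becomes the one in the
  -- theta identity.
  have h3 : th3 y (pm v r) * R3 v r y ^ (n - 1) = th3 y (pp v r) * R3 v r y ^ n := by
    rw [zpow_sub_one₀ (R3_ne_zero hy hr)]
    simp only [R3]
    field_simp
  have h0 := th3_zero_ne_zero hy
  have hb : beta v y * th3 y 0 = th3 y (Complex.I * v) := div_mul_cancel₀ _ h0
  have hq : th1 y (Complex.I * v) / th3 y 0 * th3 y 0 = th1 y (Complex.I * v) :=
    div_mul_cancel₀ _ h0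
  rw [show mu v r y n z + Complex.I * v - 1 / 2 * Complex.I * v + Complex.I * t
      = mu v r y n z + Complex.I * t + 1 / 2 * Complex.I * v by ring,
    show mu v r y n z - 1 / 2 * Complex.I * v + Complex.I * t
      = mu v r y n z + Complex.I * t - 1 / 2 * Complex.I * v by ring,
    show mu v r y n z + r + Complex.I * t = mu v r y n z + Complex.I * t + r by ring,
    show mu v r y n z - Complex.I * v + r + Complex.I * t
      = mu v r y n z + Complex.I * t - Complex.I * v + r by ring, zpow_neg]
  rw [show (r : ℂ) - 1 / 2 * Complex.I * v = pm v r by rw [pm]; ring,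
    show (r : ℂ) + 1 / 2 * Complex.I * v = pp v r by rw [pp]; ring,
    show 2 * (1 / 2 * Complex.I * v) = Complex.I * v by ring, ← hb, ← hq] at key
  generalize mu v r y n z + Complex.I * t = X at *
  refine mul_left_cancel₀ h0 ?_
  generalize th1 y (Complex.I * v) / th3 y 0 = q at *
  linear_combination alpha2 r y * R3 v r y ^ n * (ex v r y C Γ t n 0 z
      * ex v r y C Γ t (n + 1 / 2) (-(1 / 2)) z) * key
    + th3 y 0 * alpha2 r y * R3 v r y ^ n * th3 y (pp v r) * (th2 y (X + 1 / 2 * Complex.I * v)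
      * th2 y (X - Complex.I * v + r)) * e1
    - th3 y 0 * alpha2 r y * (th2 y (X + 1 / 2 * Complex.I * v) * th2 y (X - Complex.I * v + r))
      * (ex v r y C Γ t (n + 1 : ℤ) 0 z * ex v r y C Γ t ((n - 1 : ℤ) + 1 / 2) (-(1 / 2)) z) * h3
    + th3 y 0 * alpha2 r y * q * R3 v r y ^ n * th1 y (pm v r)
      * (ex v r y C Γ t n 0 z * ex v r y C Γ t (n + 1 / 2) (-(1 / 2)) z)
      * (th4 y (X - 1 / 2 * Complex.I * v) * th4 y (X + r)) * h1

theorem bilinear_transfer_odd (hy : 0 < y) (hr : ∀ j : ℤ, r ≠ 1 / 2 * (j : ℝ))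
    (hv : ∀ j : ℤ, v ≠ y * (j : ℝ)) (n : ℤ) (z : ℂ) :
    beta v y * (thetaTau v r y C Γ t).F n z * (thetaTau v r y C Γ t).g n z
      - (thetaTau v r y C Γ t).G n z * st ((thetaTau v r y C Γ t).f n) z
    = (thetaTau v r y C Γ t).F (n + 1) z * (thetaTau v r y C Γ t).g (n - 1) z := by
  rw [st_thetaTau_f]
  simp only [thetaTau, mu_add_one, mu_sub_one]
  have key := theta_identity_transfer_odd hy r (1 / 2 * Complex.I * v)
    (mu v r y n z + Complex.I * t)
  have e1 := ex_mul_ex v r y C Γ t (a := n) (b := n + 1 / 2) (c := 0) (d := 1 / 2)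
    (a' := (n + 1 : ℤ)) (b' := (n - 1 : ℤ) + 1 / 2) (c' := 0) (d' := 1 / 2)
    (by push_cast; ring) (by ring) z
  have h3 := mul_inv_cancel₀ (zpow_ne_zero n (R3_ne_zero (v := v) hy hr))
  have h1' := R1_ne_zero (r := r) hy hv
  obtain ⟨h1p, h1m⟩ := mul_ne_zero_iff.mp (th1_pp_mul_th1_pm_ne_zero (r := r) hy hv)
  have h1 : th1 y (pp v r) * R1 v r y ^ (-(n - 1)) = th1 y (pm v r) * R1 v r y ^ (-n) := by
    rw [neg_sub, sub_eq_neg_add, zpow_add_one₀ h1']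
    simp only [R1]
    field_simp
  have h0 := th3_zero_ne_zero hy
  have hb : beta v y * th3 y 0 = th3 y (Complex.I * v) := div_mul_cancel₀ _ h0
  have hq : th1 y (Complex.I * v) / th3 y 0 * th3 y 0 = th1 y (Complex.I * v) :=
    div_mul_cancel₀ _ h0
  rw [show mu v r y n z + Complex.I * v - 1 / 2 * Complex.I * v + Complex.I * t
      = mu v r y n z + Complex.I * t + 1 / 2 * Complex.I * v by ring,
    show mu v r y n z - 1 / 2 * Complex.I * v + Complex.I * t
      = mu v r y n z + Complex.I * t - 1 / 2 * Complex.I * v by ring,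
    show mu v r y n z - r + Complex.I * t = mu v r y n z + Complex.I * t - r by ring,
    show mu v r y n z - Complex.I * v - r + Complex.I * t
      = mu v r y n z + Complex.I * t - Complex.I * v - r by ring, zpow_neg (R3 v r y)]
  rw [show (r : ℂ) - 1 / 2 * Complex.I * v = pm v r by rw [pm]; ring,
    show (r : ℂ) + 1 / 2 * Complex.I * v = pp v r by rw [pp]; ring,
    show 2 * (1 / 2 * Complex.I * v) = Complex.I * v by ring, ← hb, ← hq] at key
  generalize mu v r y n z + Complex.I * t = X at *
  refine mul_left_cancel₀ h0 ?_
  generalize th1 y (Complex.I * v) / th3 y 0 = q at *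
  linear_combination alpha2 r y * R1 v r y ^ (-n) * (ex v r y C Γ t n 0 z
      * ex v r y C Γ t (n + 1 / 2) (1 / 2) z) * key
    + th3 y 0 * alpha2 r y * R1 v r y ^ (-n) * th1 y (pm v r) * (th2 y (X + 1 / 2 * Complex.I * v)
      * th4 y (X - Complex.I * v - r)) * e1
    - th3 y 0 * alpha2 r y * (th2 y (X + 1 / 2 * Complex.I * v) * th4 y (X - Complex.I * v - r))
      * (ex v r y C Γ t (n + 1 : ℤ) 0 z * ex v r y C Γ t ((n - 1 : ℤ) + 1 / 2) (1 / 2) z) * h1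
    - th3 y 0 * alpha2 r y * q * R1 v r y ^ (-n) * th3 y (pp v r)
      * (ex v r y C Γ t n 0 z * ex v r y C Γ t (n + 1 / 2) (1 / 2) z)
      * (th4 y (X - 1 / 2 * Complex.I * v) * th2 y (X - r)) * h3

/-- The duplication identity for `a`, `b` at the point `μ_n + it - r`; the constant `u₂ / (α₂ s₂)`
absorbs the factor `ϑ₃(2r) ϑ₁(iv) = s₂` it produces. -/
theorem bilinear_potential (hy : 0 < y) (hr : ∀ j : ℤ, r ≠ 1 / 2 * (j : ℝ))
    (hv : ∀ j : ℤ, v ≠ y * (j : ℝ)) (n : ℤ) (z : ℂ) :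
    (thetaTau v r y C Γ t).H (n + 1) z * (thetaTau v r y C Γ t).F n z
      - (thetaTau v r y C Γ t).H n z * (thetaTau v r y C Γ t).F (n + 1) z
    = st ((thetaTau v r y C Γ t).f n) z * (thetaTau v r y C Γ t).g n z := by
  rw [st_thetaTau_f]
  simp only [thetaTau, mu_add_one]
  have key := theta_identity_duplication hy (pm v r) (pp v r) (mu v r y n z + Complex.I * t - r)
  have e1 := ex_mul_ex v r y C Γ t (a := (n + 1 : ℤ)) (b := n) (c := 1) (d := 0)
    (a' := n + 1 / 2) (b' := n + 1 / 2) (c' := 1 / 2) (d' := 1 / 2)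
    (by push_cast; ring) (by ring) z
  have e2 := ex_mul_ex v r y C Γ t (a := n) (b := (n + 1 : ℤ)) (c := 1) (d := 0)
    (a' := n + 1 / 2) (b' := n + 1 / 2) (c' := 1 / 2) (d' := 1 / 2)
    (by push_cast; ring) (by ring) z
  have h1' := R1_ne_zero (r := r) hy hv
  have h3' := R3_ne_zero (v := v) hy hr
  obtain ⟨h1p, h1m⟩ := mul_ne_zero_iff.mp (th1_pp_mul_th1_pm_ne_zero (r := r) hy hv)
  obtain ⟨h3p, h3m⟩ := mul_ne_zero_iff.mp (th3_pp_mul_th3_pm_ne_zero (v := v) hy hr)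
  have ha := alpha2_ne_zero hy r
  have hs := s2_ne_zero (r := r) hy hv
  have hu : u2 v r y * R1 v r y ^ (-(n + 1)) * R3 v r y ^ (-(n + 1))
      = (th1 y (pp v r) * th3 y (pp v r)) ^ 2 * R1 v r y ^ (-n) * R3 v r y ^ (-n) := by
    rw [neg_add, ← sub_eq_add_neg, zpow_sub_one₀ h1', zpow_sub_one₀ h3', u2]
    simp only [R1, R3]
    field_simp
  rw [show mu v r y n z + Complex.I * v - 1 / 2 * Complex.I * v - 2 * r + Complex.I * t
      = mu v r y n z + Complex.I * t + 1 / 2 * Complex.I * v - 2 * r by ring,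
    show mu v r y n z - 1 / 2 * Complex.I * v - 2 * r + Complex.I * t
      = mu v r y n z + Complex.I * t - 1 / 2 * Complex.I * v - 2 * r by ring,
    show mu v r y n z + Complex.I * v - 1 / 2 * Complex.I * v + Complex.I * t
      = mu v r y n z + Complex.I * t + 1 / 2 * Complex.I * v by ring,
    show mu v r y n z - 1 / 2 * Complex.I * v + Complex.I * t
      = mu v r y n z + Complex.I * t - 1 / 2 * Complex.I * v by ring,
    show mu v r y n z - r + Complex.I * t = mu v r y n z + Complex.I * t - r by ring]
  generalize mu v r y n z + Complex.I * t = X at *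
  rw [show X - r - pm v r = X + 1 / 2 * Complex.I * v - 2 * r by rw [pm]; ring,
    show X - r + pm v r = X - 1 / 2 * Complex.I * v by rw [pm]; ring,
    show X - r - pp v r = X - 1 / 2 * Complex.I * v - 2 * r by rw [pp]; ring,
    show X - r + pp v r = X + 1 / 2 * Complex.I * v by rw [pp]; ring,
    show pm v r + pp v r = 2 * r by rw [pm_eq, pp_eq]; ring,
    show pp v r - pm v r = Complex.I * v by rw [pm, pp]; ring] at key
  change _ = s2 v r y * _ at key
  refine mul_left_cancel₀ hs ?_
  have hq : u2 v r y / (alpha2 r y * s2 v r y) * alpha2 r y * s2 v r y = u2 v r y := by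
    field_simp
  generalize u2 v r y / (alpha2 r y * s2 v r y) = q at *
  generalize hE : ex v r y C Γ t (n + 1 / 2) (1 / 2) z = E at *
  have hu0 : u2 v r y = th1 y (pm v r) * th3 y (pm v r) * (th1 y (pp v r) * th3 y (pp v r)) := by
    rw [u2]; ring
  rw [← hq] at hu hu0
  generalize R1 v r y ^ (-n) = ρ1 at *
  generalize R3 v r y ^ (-n) = ρ3 at *
  generalize R1 v r y ^ (-(n + 1)) = σ1 at *
  generalize R3 v r y ^ (-(n + 1)) = σ3 at *
  generalize th4 y (X + 1 / 2 * Complex.I * v - 2 * r) = A at *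
  generalize th4 y (X - 1 / 2 * Complex.I * v - 2 * r) = A' at *
  generalize th2 y (X + 1 / 2 * Complex.I * v) = B at *
  generalize th2 y (X - 1 / 2 * Complex.I * v) = B' at *
  linear_combination ρ1 * ρ3 * th1 y (pp v r) * th3 y (pp v r) * E * E * key
    + A * B' * E * E * hu - A' * B * E * E * ρ1 * ρ3 * hu0
    + q * alpha2 r y * s2 v r y * σ1 * σ3 * A * B' * e1
    - q * alpha2 r y * s2 v r y * ρ1 * ρ3 * A' * B * e2

theorem hasDerivAt_thetaTau_F (hy : 0 < y) (n : ℤ) (z : ℂ) :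
    HasDerivAt ((thetaTau v r y C Γ t).F n)
      (alpha2 r y * ex v r y C Γ t n 0 z
        * ((n * Delta3 v r y / (Delta3 v r y - Delta1 v r y) + C / 2 * t)
            * th2 y (mu v r y n z - 1 / 2 * Complex.I * v + Complex.I * t)
          + deriv (th2 y) (mu v r y n z - 1 / 2 * Complex.I * v + Complex.I * t)
            / (Delta3 v r y - Delta1 v r y))) z := by
  have hE : HasDerivAt (ex v r y C Γ t n 0) (ex v r y C Γ t n 0 z
      * (n * Delta3 v r y / (Delta3 v r y - Delta1 v r y) + C / 2 * t)) z := by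
    refine HasDerivAt.cexp ?_
    have h := ((hasDerivAt_id z).const_mul
      (n * Delta3 v r y / (Delta3 v r y - Delta1 v r y) + C / 2 * t : ℂ))
    refine ((h.add_const (0 * Γ * Complex.I * t : ℂ)).congr_of_eventuallyEq
      (Eventually.of_forall fun w => ?_)).congr_deriv (mul_one _)
    simp only [id]
    ring
  have hM : HasDerivAt (fun z => mu v r y n z - 1 / 2 * Complex.I * v + Complex.I * t)
      (1 / (Delta3 v r y - Delta1 v r y)) z :=
    ((((hasDerivAt_id z).div_const _).const_add _).sub_const _).add_const _
  refine ((hE.const_mul (alpha2 r y)).mul ((hasDerivAt_th2 hy _).comp z hM)).congr_deriv ?_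
  simp only [Function.comp_apply]
  ring

/-- Up to the common exponentials, `theta_identity_norm` contributes `Δ₃ (f f^* + g g^*)` and its
derivative in `s` contributes `-Δ₃ f f^* - Δ₁ g g^*`. The exponent `nΔ₃ / (Δ₃ - Δ₁)` and the scaling
of `z` in `μ_n` are chosen so that `f f^*` cancels and `g g^*` has coefficient one. -/
theorem bilinear_deriv (hy : 0 < y) (hr : ∀ j : ℤ, r ≠ 1 / 2 * (j : ℝ))
    (hv : ∀ j : ℤ, v ≠ y * (j : ℝ)) (n : ℤ) (z : ℂ) :
    deriv ((thetaTau v r y C Γ t).F (n + 1)) z * (thetaTau v r y C Γ t).F n z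
      - (thetaTau v r y C Γ t).F (n + 1) z * deriv ((thetaTau v r y C Γ t).F n) z
    = (thetaTau v r y C Γ t).g n z * st ((thetaTau v r y C Γ t).g n) z := by
  rw [st_thetaTau_g, (hasDerivAt_thetaTau_F C Γ t hy (n + 1) z).deriv,
    (hasDerivAt_thetaTau_F C Γ t hy n z).deriv]
  simp only [thetaTau, mu_add_one]
  have key := theta_identity_norm hy r (1 / 2 * Complex.I * v) (mu v r y n z + Complex.I * t)
  have key' := theta_identity_norm_deriv hy r (1 / 2 * Complex.I * v)
    (mu v r y n z + Complex.I * t)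
  have e1 := ex_mul_ex v r y C Γ t (a := n + 1 / 2) (b := n + 1 / 2) (c := -(1 / 2)) (d := 1 / 2)
    (a' := (n + 1 : ℤ)) (b' := n) (c' := 0) (d' := 0) (by push_cast; ring) (by ring) z
  have h1 := mul_inv_cancel₀ (zpow_ne_zero n (R1_ne_zero (r := r) hy hv))
  have hD := Delta3_sub_Delta1_ne_zero hy hr hv
  obtain ⟨h1p, h1m⟩ := mul_ne_zero_iff.mp (th1_pp_mul_th1_pm_ne_zero (r := r) hy hv)
  obtain ⟨h3p, h3m⟩ := mul_ne_zero_iff.mp (th3_pp_mul_th3_pm_ne_zero (v := v) hy hr)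
  have hd3 : deriv (th3 y) (pm v r) * th3 y (pp v r) - th3 y (pm v r) * deriv (th3 y) (pp v r)
      = Delta3 v r y * (th3 y (pm v r) * th3 y (pp v r)) := by
    rw [Delta3, d3, d3]
    field_simp
  have hd1 : deriv (th1 y) (pm v r) * th1 y (pp v r) - th1 y (pm v r) * deriv (th1 y) (pp v r)
      = Delta1 v r y * (th1 y (pm v r) * th1 y (pp v r)) := by
    rw [Delta1, d1, d1]
    field_simp
  rw [show mu v r y n z + Complex.I * v - 1 / 2 * Complex.I * v + Complex.I * t
      = mu v r y n z + Complex.I * t + 1 / 2 * Complex.I * v by ring,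
    show mu v r y n z - 1 / 2 * Complex.I * v + Complex.I * t
      = mu v r y n z + Complex.I * t - 1 / 2 * Complex.I * v by ring,
    show mu v r y n z + r + Complex.I * t = mu v r y n z + Complex.I * t + r by ring,
    show mu v r y n z - r + Complex.I * t = mu v r y n z + Complex.I * t - r by ring, zpow_neg]
  rw [← alpha2_sq, show (r : ℂ) - 1 / 2 * Complex.I * v = pm v r by rw [pm]; ring,
    show (r : ℂ) + 1 / 2 * Complex.I * v = pp v r by rw [pp]; ring] at key key'
  generalize mu v r y n z + Complex.I * t = X at *
  refine mul_left_cancel₀ hD ?_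
  generalize hq : Delta3 v r y / (Delta3 v r y - Delta1 v r y) = q at *
  have hq' : q * (Delta3 v r y - Delta1 v r y) = Delta3 v r y := by
    rw [← hq, div_mul_cancel₀ _ hD]
  simp only [mul_div_assoc, hq]
  generalize hw : (Delta3 v r y - Delta1 v r y) = W at *
  have hW : W * W⁻¹ = 1 := mul_inv_cancel₀ hD
  generalize ex v r y C Γ t ((n + 1 : ℤ)) 0 z = E1 at *
  generalize ex v r y C Γ t n 0 z = E0 at *
  push_cast
  linear_combination alpha2 r y ^ 2 * E1 * E0 * (th2 y (X + 1 / 2 * Complex.I * v)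
      * th2 y (X - 1 / 2 * Complex.I * v)) * hq'
    + alpha2 r y ^ 2 * E1 * E0 * (deriv (th2 y) (X + 1 / 2 * Complex.I * v)
        * th2 y (X - 1 / 2 * Complex.I * v)
      - th2 y (X + 1 / 2 * Complex.I * v) * deriv (th2 y) (X - 1 / 2 * Complex.I * v)) * hW
    - E1 * E0 * Delta3 v r y * key - E1 * E0 * key'
    - E1 * E0 * (th2 y (X + r) * th2 y (X - r)) * hd3
    - E1 * E0 * (th4 y (X + r) * th4 y (X - r)) * hd1
    + th1 y (pm v r) * th1 y (pp v r) * (th4 y (X + r) * th4 y (X - r))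
      * (E1 * E0 * hw - W * e1 - W * (ex v r y C Γ t (n + 1 / 2) (-(1 / 2)) z
        * ex v r y C Γ t (n + 1 / 2) (1 / 2) z) * h1)

theorem G_mul_st_G (hy : 0 < y) (hr : ∀ j : ℤ, r ≠ 1 / 2 * (j : ℝ))
    (hv : ∀ j : ℤ, v ≠ y * (j : ℝ)) (n : ℤ) (z : ℂ) :
    (thetaTau v r y C Γ t).G n z * st ((thetaTau v r y C Γ t).G n) z
      = (thetaTau v r y C Γ t).Gt n z ^ 2 := by
  rw [st_thetaTau_G C Γ t hy]
  simp only [thetaTau]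
  have h1 := mul_inv_cancel₀ (zpow_ne_zero n (R1_ne_zero (r := r) hy hv))
  have h3 := mul_inv_cancel₀ (zpow_ne_zero n (R3_ne_zero (v := v) hy hr))
  rw [zpow_neg, zpow_neg]
  generalize R3 v r y ^ n = ρ3 at *
  generalize R1 v r y ^ n = ρ1 at *
  generalize th1 y (Complex.I * v) / th3 y 0 = q
  generalize th4 y _ = T
  linear_combination -(alpha2 r y * q * ex v r y C Γ t n 0 z * T) ^ 2
    * (ρ3 * ρ3⁻¹ * h1 + h3 + Complex.I_sq)

theorem isTau_thetaTau (hy : 0 < y) (hr : ∀ j : ℤ, r ≠ 1 / 2 * (j : ℝ))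
    (hv : ∀ j : ℤ, v ≠ y * (j : ℝ)) : IsTau (thetaTau v r y C Γ t) (beta v y) where
  real_const := beta_im hy v
  real_F n := im_eq_zero_of_st_eq (st_thetaTau_F C Γ t hy n)
  real_Gt n := im_eq_zero_of_st_eq (st_thetaTau_Gt C Γ t hy n)
  differentiable_F n z := (hasDerivAt_thetaTau_F C Γ t hy n z).differentiableAt
  i1 := bilinear_norm C Γ t hy hr hv
  i2 := bilinear_transfer_even C Γ t hy hr hv
  i3 := bilinear_transfer_odd C Γ t hy hr hv
  i4 := bilinear_potential C Γ t hy hr hv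
  i5 := bilinear_deriv C Γ t hy hr hv
  i6 := G_mul_st_G C Γ t hy hr hv
  i6_real n x := by
    rw [← G_mul_st_G C Γ t hy hr hv, st, Complex.conj_ofReal, Complex.mul_conj']
    push_cast
    rfl

end ThetaTau

/-! ### Discrete Frenet frames -/

theorem frame_mem_specialOrthogonalGroup {T N B : EuclideanSpace ℝ (Fin 3)}
    (hTT : T 0 ^ 2 + T 1 ^ 2 + T 2 ^ 2 = 1) (hNN : N 0 ^ 2 + N 1 ^ 2 + N 2 ^ 2 = 1)
    (hBB : B 0 ^ 2 + B 1 ^ 2 + B 2 ^ 2 = 1) (hTN : T 0 * N 0 + T 1 * N 1 + T 2 * N 2 = 0)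
    (hTB : T 0 * B 0 + T 1 * B 1 + T 2 * B 2 = 0) (hNB : N 0 * B 0 + N 1 * B 1 + N 2 * B 2 = 0)
    (h0 : T 1 * N 2 - T 2 * N 1 = B 0) (h1 : T 2 * N 0 - T 0 * N 2 = B 1)
    (h2 : T 0 * N 1 - T 1 * N 0 = B 2) :
    frame T N B ∈ Matrix.specialOrthogonalGroup (Fin 3) ℝ := by
  rw [Matrix.mem_specialOrthogonalGroup_iff, Matrix.mem_orthogonalGroup_iff']
  constructor
  · ext i j
    fin_cases i <;> fin_cases j <;>
      simp [frame, Matrix.mul_apply, Fin.sum_univ_three] <;> linarith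
  · rw [Matrix.det_fin_three]
    simp only [frame, Matrix.of_apply, Matrix.cons_val_zero, Matrix.cons_val_one, Matrix.cons_val]
    linear_combination hBB + B 0 * h0 + B 1 * h1 + B 2 * h2

/-- Relations between the columns of a rotation matrix. -/
theorem frame_relations {T N B : EuclideanSpace ℝ (Fin 3)}
    (h : frame T N B ∈ Matrix.specialOrthogonalGroup (Fin 3) ℝ) :
    inner ℝ T T = 1 ∧ inner ℝ N N = 1 ∧ inner ℝ B B = 1 ∧ inner ℝ N T = 0 ∧ inner ℝ B T = 0 ∧
      inner ℝ N B = 0 ∧ cross N B = T ∧ cross B T = N := by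
  rw [Matrix.mem_specialOrthogonalGroup_iff, Matrix.mem_orthogonalGroup_iff'] at h
  obtain ⟨ho, hd⟩ := h
  -- For a rotation the adjugate equals the transpose; read entrywise this gives the cross product
  -- relations.
  have hadj : (frame T N B).adjugate = (frame T N B).transpose := by
    calc (frame T N B).adjugate
        = (frame T N B).transpose * frame T N B * (frame T N B).adjugate := by rw [ho, one_mul]
      _ = _ := by rw [mul_assoc, Matrix.mul_adjugate, hd, one_smul, mul_one]
  rw [Matrix.adjugate_fin_three] at hadj
  have hoe := fun i j => congrFun (congrFun ho i) j
  have hae := fun i j => congrFun (congrFun hadj i) j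
  simp [frame, Fin.forall_fin_succ, Matrix.mul_apply, Fin.sum_univ_three] at hoe hae
  simp only [PiLp.inner_apply, Fin.sum_univ_three, RCLike.inner_apply, conj_trivial]
  refine ⟨?_, ?_, ?_, ?_, ?_, ?_, ?_, ?_⟩
  · linarith [hoe.1.1]
  · linarith [hoe.2.1.2.1]
  · linarith [hoe.2.2.2.2]
  · linarith [hoe.1.2.1]
  · linarith [hoe.1.2.2]
  · linarith [hoe.2.1.2.2]
  · ext i
    fin_cases i <;> simp [cross, crossProduct] <;> linarith [hae.1.1, hae.1.2.1, hae.1.2.2]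
  · ext i
    fin_cases i <;> simp [cross, crossProduct] <;>
      linarith [hae.2.1.1, hae.2.1.2.1, hae.2.1.2.2]

theorem cross_self_eq_zero (B : EuclideanSpace ℝ (Fin 3)) : cross B B = 0 := by
  rw [cross, cross_self]
  rfl

theorem cross_smul_add_smul (a b : ℝ) (u v w : EuclideanSpace ℝ (Fin 3)) :
    cross (a • u + b • v) w = a • cross u w + b • cross v w := by
  simp [cross]

/-- A sequence of rotations satisfying the discrete Frenet equations with constant torsion angle
is a discrete Frenet frame. -/
theorem isFrenetFramed_of_frenet {γ T N B : ℤ → EuclideanSpace ℝ (Fin 3)} {l : ℝ} {κ : ℤ → ℝ}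
    (hS : ∀ n, frame (T n) (N n) (B n) ∈ Matrix.specialOrthogonalGroup (Fin 3) ℝ)
    (hγ : ∀ n, γ (n + 1) = γ n + T n)
    (hT : ∀ n, T n = Real.cos (κ (n + 1)) • T (n + 1) - Real.sin (κ (n + 1)) • N (n + 1))
    (hN : ∀ n, N n = Real.cos l • (Real.sin (κ (n + 1)) • T (n + 1)
      + Real.cos (κ (n + 1)) • N (n + 1)) + Real.sin l • B (n + 1))
    (hB : ∀ n, B n = -Real.sin l • (Real.sin (κ (n + 1)) • T (n + 1)
      + Real.cos (κ (n + 1)) • N (n + 1)) + Real.cos l • B (n + 1))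
    (hκ : ∀ n, -Real.pi < κ n ∧ κ n < Real.pi) (hl : -Real.pi < l ∧ l < Real.pi ∧ l ≠ 0) :
    IsFrenetFramed γ T N B (fun _ => l) κ := by
  have hfr : ∀ n, frame (T (n + 1)) (N (n + 1)) (B (n + 1))
      = frame (T n) (N n) (B n) * (M1 (-l) * M3 (κ (n + 1))) := fun n => by
    have c1 := Real.sin_sq_add_cos_sq l
    have c2 := Real.sin_sq_add_cos_sq (κ (n + 1))
    rw [hT n, hN n, hB n]
    ext i j
    fin_cases j
    · simp [frame, M1, M3, Matrix.mul_apply, Fin.sum_univ_three]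
      linear_combination -T (n + 1) i * c2 - (T (n + 1) i * Real.sin (κ (n + 1)) ^ 2
        + Real.cos (κ (n + 1)) * Real.sin (κ (n + 1)) * N (n + 1) i) * c1
    · simp [frame, M1, M3, Matrix.mul_apply, Fin.sum_univ_three]
      linear_combination -N (n + 1) i * c2 - (N (n + 1) i * Real.cos (κ (n + 1)) ^ 2
        + Real.cos (κ (n + 1)) * Real.sin (κ (n + 1)) * T (n + 1) i) * c1
    · simp [frame, M1, M3, Matrix.mul_apply, Fin.sum_univ_three]
      linear_combination -B (n + 1) i * c1
  have hrel := fun n => frame_relations (hS n)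
  refine
    { special_orthogonal := hS
      curve_succ := hγ
      tangent_eq := fun n => ?_
      normal_eq := fun n => (hrel n).2.2.2.2.2.2.2.symm
      frenet := hfr
      curvature_angle := fun n => ?_
      curvature_range := hκ
      torsion_angle := fun n => ?_
      torsion_range := fun _ => hl }
  · have hBn : B (n + 1) = Real.sin l • N n + Real.cos l • B n := by
      rw [hN n, hB n]
      ext i
      simp
      linear_combination -B (n + 1) i * Real.sin_sq_add_cos_sq l
    -- On `(-π, π)` the sine has the sign of its argument, so normalising this vector costs exactly
    -- the sign of `l`.
    have hc : cross (B (n + 1)) (B n) = Real.sin l • T n := by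
      rw [hBn, cross_smul_add_smul, cross_self_eq_zero, (hrel n).2.2.2.2.2.2.1, smul_zero, add_zero]
    have hT1 : ‖T n‖ = 1 := by
      have := (hrel n).1
      rwa [real_inner_self_eq_norm_sq, pow_eq_one_iff_of_nonneg (norm_nonneg _) two_ne_zero] at this
    rw [hc, norm_smul, hT1, mul_one, Real.norm_eq_abs, smul_smul]
    nth_rw 1 [← one_smul ℝ (T n)]
    congr 1
    obtain ⟨hl1, hl2, hl0⟩ := hl
    rcases lt_or_gt_of_ne hl0 with h | h
    · have hs := Real.sin_neg_of_neg_of_neg_pi_lt h hl1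
      rw [Real.sign_of_neg h, abs_of_neg hs]
      field_simp [hs.ne]
    · have hs := Real.sin_pos_of_pos_of_lt_pi h hl2
      rw [Real.sign_of_pos h, abs_of_pos hs]
      field_simp [hs.ne']
  · have h := hT (n - 1)
    rw [sub_add_cancel] at h
    rw [h, inner_sub_right, inner_smul_right, inner_smul_right, (hrel n).1, real_inner_comm,
      (hrel n).2.2.2.1]
    ring
  · have h := hB (n - 1)
    rw [sub_add_cancel] at h
    rw [h, inner_add_right, inner_smul_right, inner_smul_right, inner_add_right, inner_smul_right,
      inner_smul_right, (hrel n).2.2.1, (hrel n).2.2.2.2.1, real_inner_comm, (hrel n).2.2.2.2.2.1]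
    ring

/-! ### The frame of a family of τ-functions -/

/-- `D • T`. -/
def tanVec (f f' g g' : ℂ) : Fin 3 → ℂ :=
  ![f' * g + f * g', -Complex.I * (f' * g - f * g'), f * f' - g * g']

/-- `D • (N - i B)`. -/
def nullVec (f' g' ρ : ℂ) : Fin 3 → ℂ :=
  ![2 * ρ * (f' ^ 2 - g' ^ 2), -Complex.I * (2 * ρ * (f' ^ 2 + g' ^ 2)), -4 * (f' * g' * ρ)]

/-- `D • (N + i B)`. -/
def nullVecConj (f g ρ' : ℂ) : Fin 3 → ℂ :=
  ![2 * ρ' * (f ^ 2 - g ^ 2), Complex.I * (2 * ρ' * (f ^ 2 + g ^ 2)), -4 * (f * g * ρ')]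

theorem Tau.tangentC_eq (τ : Tau) (n : ℤ) (i : Fin 3) : τ.tangentC n i = (τ.nrm n)⁻¹
    * tanVec (τ.f n 0) (conj (τ.f n 0)) (τ.g n 0) (conj (τ.g n 0)) i := by
  fin_cases i <;> simp [Tau.tangentC, tanVec]

theorem Tau.normalC_eq (τ : Tau) (n : ℤ) (i : Fin 3) : τ.normalC n i = (τ.nrm n)⁻¹
    * ((nullVec (conj (τ.f n 0)) (conj (τ.g n 0)) (τ.rho n) i
      + nullVecConj (τ.f n 0) (τ.g n 0) (conj (τ.rho n)) i) / 2) := by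
  fin_cases i <;> simp [Tau.normalC, nullVec, nullVecConj] <;> first | (left; ring) | ring

theorem Tau.binormalC_eq (τ : Tau) (n : ℤ) (i : Fin 3) : τ.binormalC n i = (τ.nrm n)⁻¹
    * (Complex.I * (nullVec (conj (τ.f n 0)) (conj (τ.g n 0)) (τ.rho n) i
      - nullVecConj (τ.f n 0) (τ.g n 0) (conj (τ.rho n)) i) / 2) := by
  have := Complex.I_sq
  fin_cases i <;> simp [Tau.binormalC, nullVec, nullVecConj] <;> first | (left; grind) | ring

theorem conj_tanVec (f g : ℂ) (i : Fin 3) :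
    conj (tanVec f (conj f) g (conj g) i) = tanVec f (conj f) g (conj g) i := by
  fin_cases i <;> simp [tanVec] <;> ring

theorem conj_nullVec (f g ρ : ℂ) (i : Fin 3) :
    conj (nullVec (conj f) (conj g) ρ i) = nullVecConj f g (conj ρ) i := by
  fin_cases i <;> simp [nullVec, nullVecConj, Complex.conj_ofNat]

theorem conj_nullVecConj (f g ρ : ℂ) (i : Fin 3) :
    conj (nullVecConj f g (conj ρ) i) = nullVec (conj f) (conj g) ρ i := by
  rw [← conj_nullVec, Complex.conj_conj]

theorem Tau.conj_nrm (τ : Tau) (n : ℤ) : conj (τ.nrm n) = τ.nrm n := by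
  simp [Tau.nrm, mul_comm]

theorem ofReal_re_of_conj_eq {z : ℂ} (h : conj z = z) : ((z.re : ℝ) : ℂ) = z :=
  Complex.conj_eq_iff_re.mp h

theorem Tau.conj_tangentC (τ : Tau) (n : ℤ) (i : Fin 3) : conj (τ.tangentC n i) = τ.tangentC n i := by
  rw [Tau.tangentC_eq, map_mul, map_inv₀, Tau.conj_nrm, conj_tanVec]

theorem Tau.conj_normalC (τ : Tau) (n : ℤ) (i : Fin 3) : conj (τ.normalC n i) = τ.normalC n i := by
  rw [Tau.normalC_eq, map_mul, map_inv₀, Tau.conj_nrm, map_div₀, map_add, conj_nullVec,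
    conj_nullVecConj, Complex.conj_ofNat, add_comm]

theorem Tau.conj_binormalC (τ : Tau) (n : ℤ) (i : Fin 3) :
    conj (τ.binormalC n i) = τ.binormalC n i := by
  rw [Tau.binormalC_eq, map_mul, map_inv₀, Tau.conj_nrm, map_div₀, map_mul, map_sub, conj_nullVec,
    conj_nullVecConj, Complex.conj_ofNat, Complex.conj_I]
  ring

theorem Tau.ofReal_tangent (τ : Tau) (n : ℤ) (i : Fin 3) :
    ((τ.tangent n i : ℝ) : ℂ) = τ.tangentC n i := ofReal_re_of_conj_eq (τ.conj_tangentC n i)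

theorem Tau.ofReal_normal (τ : Tau) (n : ℤ) (i : Fin 3) :
    ((τ.normal n i : ℝ) : ℂ) = τ.normalC n i := ofReal_re_of_conj_eq (τ.conj_normalC n i)

theorem Tau.ofReal_binormal (τ : Tau) (n : ℤ) (i : Fin 3) :
    ((τ.binormal n i : ℝ) : ℂ) = τ.binormalC n i := ofReal_re_of_conj_eq (τ.conj_binormalC n i)

theorem Tau.normal_sub_I_mul_binormal (τ : Tau) (n : ℤ) (i : Fin 3) :
    (τ.normal n i : ℂ) - Complex.I * τ.binormal n i
      = (τ.nrm n)⁻¹ * nullVec (conj (τ.f n 0)) (conj (τ.g n 0)) (τ.rho n) i := by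
  rw [τ.ofReal_normal, τ.ofReal_binormal, τ.normalC_eq, τ.binormalC_eq]
  linear_combination -(τ.nrm n)⁻¹ * (nullVec (conj (τ.f n 0)) (conj (τ.g n 0)) (τ.rho n) i
    - nullVecConj (τ.f n 0) (τ.g n 0) (conj (τ.rho n)) i) / 2 * Complex.I_sq

theorem Tau.normal_add_I_mul_binormal (τ : Tau) (n : ℤ) (i : Fin 3) :
    (τ.normal n i : ℂ) + Complex.I * τ.binormal n i
      = (τ.nrm n)⁻¹ * nullVecConj (τ.f n 0) (τ.g n 0) (conj (τ.rho n)) i := by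
  rw [τ.ofReal_normal, τ.ofReal_binormal, τ.normalC_eq, τ.binormalC_eq]
  linear_combination (τ.nrm n)⁻¹ * (nullVec (conj (τ.f n 0)) (conj (τ.g n 0)) (τ.rho n) i
    - nullVecConj (τ.f n 0) (τ.g n 0) (conj (τ.rho n)) i) / 2 * Complex.I_sq

/-! ### Algebra of the spinor representation of the frame -/

section Algebra

variable {f f' g g' ρ ρ' : ℂ}

theorem tanVec_sq (f f' g g' : ℂ) : tanVec f f' g g' 0 ^ 2 + tanVec f f' g g' 1 ^ 2
    + tanVec f f' g g' 2 ^ 2 = (f * f' + g * g') ^ 2 := by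
  simp only [tanVec, Matrix.cons_val_zero, Matrix.cons_val_one, Matrix.cons_val]
  linear_combination (f' * g - f * g') ^ 2 * Complex.I_sq

theorem nullVec_sq (f' g' ρ : ℂ) : nullVec f' g' ρ 0 ^ 2 + nullVec f' g' ρ 1 ^ 2
    + nullVec f' g' ρ 2 ^ 2 = 0 := by
  simp only [nullVec, Matrix.cons_val_zero, Matrix.cons_val_one, Matrix.cons_val]
  linear_combination (2 * ρ * (f' ^ 2 + g' ^ 2)) ^ 2 * Complex.I_sq

theorem nullVec_mul_nullVecConj (h : 4 * ρ * ρ' = 1) :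
    nullVec f' g' ρ 0 * nullVecConj f g ρ' 0 + nullVec f' g' ρ 1 * nullVecConj f g ρ' 1
      + nullVec f' g' ρ 2 * nullVecConj f g ρ' 2 = 2 * (f * f' + g * g') ^ 2 := by
  simp only [nullVec, nullVecConj, Matrix.cons_val_zero, Matrix.cons_val_one, Matrix.cons_val]
  linear_combination -(2 * ρ * (f' ^ 2 + g' ^ 2)) * (2 * ρ' * (f ^ 2 + g ^ 2)) * Complex.I_sq
    + 2 * (f * f' + g * g') ^ 2 * h

theorem tanVec_mul_nullVec (f f' g g' ρ : ℂ) : tanVec f f' g g' 0 * nullVec f' g' ρ 0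
    + tanVec f f' g g' 1 * nullVec f' g' ρ 1 + tanVec f f' g g' 2 * nullVec f' g' ρ 2 = 0 := by
  simp only [tanVec, nullVec, Matrix.cons_val_zero, Matrix.cons_val_one, Matrix.cons_val]
  linear_combination (f' * g - f * g') * (2 * ρ * (f' ^ 2 + g' ^ 2)) * Complex.I_sq

theorem tanVec_cross_nullVec (f f' g g' ρ : ℂ) :
    tanVec f f' g g' 1 * nullVec f' g' ρ 2 - tanVec f f' g g' 2 * nullVec f' g' ρ 1
        = (f * f' + g * g') * (Complex.I * nullVec f' g' ρ 0) ∧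
      tanVec f f' g g' 2 * nullVec f' g' ρ 0 - tanVec f f' g g' 0 * nullVec f' g' ρ 2
        = (f * f' + g * g') * (Complex.I * nullVec f' g' ρ 1) ∧
      tanVec f f' g g' 0 * nullVec f' g' ρ 1 - tanVec f f' g g' 1 * nullVec f' g' ρ 0
        = (f * f' + g * g') * (Complex.I * nullVec f' g' ρ 2) := by
  simp only [tanVec, nullVec, Matrix.cons_val_zero, Matrix.cons_val_one, Matrix.cons_val]
  refine ⟨by ring, ?_, by ring⟩
  linear_combination (f * f' + g * g') * (2 * ρ * (f' ^ 2 + g' ^ 2)) * Complex.I_sq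

/-- As `4ρρ' = 1`, the spinor map is a similarity of factor `p² + q²` on squared norms; the tangent
is quadratic in the spinor, whence the double-angle coefficients `p² - q²` and `2pq`. -/
theorem tanVec_transfer (h : 4 * ρ * ρ' = 1) (p q : ℂ) (i : Fin 3) :
    tanVec (p * f + 2 * ρ * q * g') (p * f' + 2 * ρ' * q * g) (p * g - 2 * ρ * q * f')
      (p * g' - 2 * ρ' * q * f) i
    = (p ^ 2 - q ^ 2) * tanVec f f' g g' i
      - p * q * (nullVec f' g' ρ i + nullVecConj f g ρ' i) := by
  fin_cases i <;> simp [tanVec, nullVec, nullVecConj]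
  · linear_combination -q ^ 2 * (f' * g + f * g') * h
  · linear_combination -q ^ 2 * (-Complex.I * (f' * g - f * g')) * h
  · linear_combination -q ^ 2 * (f * f' - g * g') * h

/-- The isotropic vector is linear in `ρ`, so a phase `e` in `ρ` factors out: it becomes a rotation
of the normal plane, that is, the torsion. -/
theorem nullVec_transfer (h : 4 * ρ * ρ' = 1) (p q e : ℂ) (i : Fin 3) :
    nullVec (p * f' + 2 * ρ' * q * g) (p * g' - 2 * ρ' * q * f) (ρ * e) i
    = e * (p ^ 2 * nullVec f' g' ρ i + 2 * p * q * tanVec f f' g g' i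
      - q ^ 2 * nullVecConj f g ρ' i) := by
  fin_cases i <;> simp [tanVec, nullVec, nullVecConj]
  · linear_combination e * (2 * p * q * (f' * g + f * g') - q ^ 2 * (2 * ρ' * (f ^ 2 - g ^ 2))) * h
  · linear_combination e * (2 * p * q * (-Complex.I * (f' * g - f * g'))
      - q ^ 2 * (Complex.I * (2 * ρ' * (f ^ 2 + g ^ 2)))) * h
  · linear_combination e * (2 * p * q * (f * f' - g * g') - q ^ 2 * (-4 * (f * g * ρ'))) * h

end Algebra

theorem Tau.frame_mem_specialOrthogonalGroup (τ : Tau) (n : ℤ) (hD : τ.nrm n ≠ 0)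
    (hρ : 4 * τ.rho n * conj (τ.rho n) = 1) :
    frame (τ.tangent n) (τ.normal n) (τ.binormal n) ∈ Matrix.specialOrthogonalGroup (Fin 3) ℝ := by
  have hT := fun i => (τ.ofReal_tangent n i).trans (τ.tangentC_eq n i)
  have hW := τ.normal_sub_I_mul_binormal n
  have hW' := τ.normal_add_I_mul_binormal n
  have hd : (τ.nrm n)⁻¹ * τ.nrm n = 1 := inv_mul_cancel₀ hD
  have hDe : τ.nrm n = τ.f n 0 * conj (τ.f n 0) + τ.g n 0 * conj (τ.g n 0) := rfl
  have e1 := tanVec_sq (τ.f n 0) (conj (τ.f n 0)) (τ.g n 0) (conj (τ.g n 0))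
  have e2 := nullVec_sq (conj (τ.f n 0)) (conj (τ.g n 0)) (τ.rho n)
  have e3 := nullVec_mul_nullVecConj (f := τ.f n 0) (f' := conj (τ.f n 0)) (g := τ.g n 0)
    (g' := conj (τ.g n 0)) hρ
  have e4 := tanVec_mul_nullVec (τ.f n 0) (conj (τ.f n 0)) (τ.g n 0) (conj (τ.g n 0)) (τ.rho n)
  obtain ⟨e5, e6, e7⟩ :=
    tanVec_cross_nullVec (τ.f n 0) (conj (τ.f n 0)) (τ.g n 0) (conj (τ.g n 0)) (τ.rho n)
  rw [← hDe] at e1 e3 e5 e6 e7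
  have r1 : (τ.tangent n 0 : ℂ) ^ 2 + τ.tangent n 1 ^ 2 + τ.tangent n 2 ^ 2 = 1 := by
    rw [hT, hT, hT]
    linear_combination (τ.nrm n)⁻¹ ^ 2 * e1 + ((τ.nrm n)⁻¹ * τ.nrm n + 1) * hd
  have r2 : ((τ.normal n 0 : ℂ) - Complex.I * τ.binormal n 0) ^ 2
      + ((τ.normal n 1 : ℂ) - Complex.I * τ.binormal n 1) ^ 2
      + ((τ.normal n 2 : ℂ) - Complex.I * τ.binormal n 2) ^ 2 = 0 := by
    rw [hW, hW, hW]
    linear_combination (τ.nrm n)⁻¹ ^ 2 * e2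
  have r3 : ((τ.normal n 0 : ℂ) - Complex.I * τ.binormal n 0)
        * ((τ.normal n 0 : ℂ) + Complex.I * τ.binormal n 0)
      + ((τ.normal n 1 : ℂ) - Complex.I * τ.binormal n 1)
        * ((τ.normal n 1 : ℂ) + Complex.I * τ.binormal n 1)
      + ((τ.normal n 2 : ℂ) - Complex.I * τ.binormal n 2)
        * ((τ.normal n 2 : ℂ) + Complex.I * τ.binormal n 2) = 2 := by
    simp only [hW, hW']
    linear_combination (τ.nrm n)⁻¹ ^ 2 * e3 + 2 * ((τ.nrm n)⁻¹ * τ.nrm n + 1) * hd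
  have r4 : (τ.tangent n 0 : ℂ) * ((τ.normal n 0 : ℂ) - Complex.I * τ.binormal n 0)
      + τ.tangent n 1 * ((τ.normal n 1 : ℂ) - Complex.I * τ.binormal n 1)
      + τ.tangent n 2 * ((τ.normal n 2 : ℂ) - Complex.I * τ.binormal n 2) = 0 := by
    simp only [hT, hW]
    linear_combination (τ.nrm n)⁻¹ ^ 2 * e4
  -- `T × (N - iB) = i (N - iB)` has real part `T × N = B`, which fixes the orientation.
  have r5 : (τ.tangent n 1 : ℂ) * ((τ.normal n 2 : ℂ) - Complex.I * τ.binormal n 2)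
      - τ.tangent n 2 * ((τ.normal n 1 : ℂ) - Complex.I * τ.binormal n 1)
      = Complex.I * ((τ.normal n 0 : ℂ) - Complex.I * τ.binormal n 0) := by
    simp only [hT, hW]
    linear_combination (τ.nrm n)⁻¹ ^ 2 * e5 + (τ.nrm n)⁻¹ * Complex.I
      * nullVec (conj (τ.f n 0)) (conj (τ.g n 0)) (τ.rho n) 0 * hd
  have r6 : (τ.tangent n 2 : ℂ) * ((τ.normal n 0 : ℂ) - Complex.I * τ.binormal n 0)
      - τ.tangent n 0 * ((τ.normal n 2 : ℂ) - Complex.I * τ.binormal n 2)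
      = Complex.I * ((τ.normal n 1 : ℂ) - Complex.I * τ.binormal n 1) := by
    simp only [hT, hW]
    linear_combination (τ.nrm n)⁻¹ ^ 2 * e6 + (τ.nrm n)⁻¹ * Complex.I
      * nullVec (conj (τ.f n 0)) (conj (τ.g n 0)) (τ.rho n) 1 * hd
  have r7 : (τ.tangent n 0 : ℂ) * ((τ.normal n 1 : ℂ) - Complex.I * τ.binormal n 1)
      - τ.tangent n 1 * ((τ.normal n 0 : ℂ) - Complex.I * τ.binormal n 0)
      = Complex.I * ((τ.normal n 2 : ℂ) - Complex.I * τ.binormal n 2) := by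
    simp only [hT, hW]
    linear_combination (τ.nrm n)⁻¹ ^ 2 * e7 + (τ.nrm n)⁻¹ * Complex.I
      * nullVec (conj (τ.f n 0)) (conj (τ.g n 0)) (τ.rho n) 2 * hd
  have r2r := congrArg Complex.re r2
  have r2i := congrArg Complex.im r2
  have r3r := congrArg Complex.re r3
  have r4r := congrArg Complex.re r4
  have r4i := congrArg Complex.im r4
  have r5r := congrArg Complex.re r5
  have r6r := congrArg Complex.re r6
  have r7r := congrArg Complex.re r7
  simp [pow_two] at r2r r2i r3r r4r r4i r5r r6r r7r
  refine Kaleidocycle.frame_mem_specialOrthogonalGroup 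
    (Complex.ofReal_injective (by push_cast; exact r1)) ?_ ?_ ?_ ?_ ?_ ?_ ?_ ?_
  all_goals linarith

/-- The pair `(p, q)` gives the half angle of the rotation by `κ`, and the phase quotient of `ρ`
gives the rotation by `l`. Treating `N - iB` as one complex vector yields normal and binormal as its
real and imaginary parts. -/
theorem Tau.frame_transfer (τ : Tau) (n : ℤ) {p q l κ : ℝ} (hpq : 0 < p ^ 2 + q ^ 2)
    (hρ : 4 * τ.rho (n + 1) * conj (τ.rho (n + 1)) = 1)
    (hρs : τ.rho n = τ.rho (n + 1) * Complex.exp (l * Complex.I))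
    (hf : τ.f n 0 = p * τ.f (n + 1) 0 + 2 * τ.rho (n + 1) * q * conj (τ.g (n + 1) 0))
    (hg : τ.g n 0 = p * τ.g (n + 1) 0 - 2 * τ.rho (n + 1) * q * conj (τ.f (n + 1) 0))
    (hc : Real.cos κ = (p ^ 2 - q ^ 2) / (p ^ 2 + q ^ 2))
    (hs : Real.sin κ = 2 * p * q / (p ^ 2 + q ^ 2)) :
    τ.tangent n = Real.cos κ • τ.tangent (n + 1) - Real.sin κ • τ.normal (n + 1) ∧
    τ.normal n = Real.cos l • (Real.sin κ • τ.tangent (n + 1) + Real.cos κ • τ.normal (n + 1))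
      + Real.sin l • τ.binormal (n + 1) ∧
    τ.binormal n = -Real.sin l • (Real.sin κ • τ.tangent (n + 1)
      + Real.cos κ • τ.normal (n + 1)) + Real.cos l • τ.binormal (n + 1) := by
  have hf' : conj (τ.f n 0) = p * conj (τ.f (n + 1) 0)
      + 2 * conj (τ.rho (n + 1)) * q * τ.g (n + 1) 0 := by
    rw [hf]; simp [Complex.conj_ofNat]
  have hg' : conj (τ.g n 0) = p * conj (τ.g (n + 1) 0)
      - 2 * conj (τ.rho (n + 1)) * q * τ.f (n + 1) 0 := by
    rw [hg]; simp [Complex.conj_ofNat]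
  have hD : τ.nrm n = (p ^ 2 + q ^ 2) * τ.nrm (n + 1) := by
    rw [Tau.nrm, Tau.nrm, hf', hg', hf, hg]
    linear_combination (q ^ 2 * (τ.f (n + 1) 0 * conj (τ.f (n + 1) 0)
      + τ.g (n + 1) 0 * conj (τ.g (n + 1) 0)) : ℂ) * hρ
  have hpq' : (p ^ 2 + q ^ 2 : ℂ) ≠ 0 := by exact_mod_cast hpq.ne'
  have hcC : (Real.cos κ : ℂ) = (p ^ 2 - q ^ 2) / (p ^ 2 + q ^ 2) := by
    rw [hc]; push_cast; rfl
  have hsC : (Real.sin κ : ℂ) = 2 * p * q / (p ^ 2 + q ^ 2) := by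
    rw [hs]; push_cast; rfl
  have hT := fun n i => (τ.ofReal_tangent n i).trans (τ.tangentC_eq n i)
  have hN := fun n i => (τ.ofReal_normal n i).trans (τ.normalC_eq n i)
  have hW := τ.normal_sub_I_mul_binormal
  have kT : ∀ i, (τ.tangent n i : ℂ)
      = Real.cos κ * τ.tangent (n + 1) i - Real.sin κ * τ.normal (n + 1) i := fun i => by
    rw [hT, hT, hN, hf', hg', hf, hg, tanVec_transfer hρ, hD, hcC, hsC]
    field_simp
  have kW : ∀ i, (τ.normal n i : ℂ) - Complex.I * τ.binormal n i
      = Complex.exp (l * Complex.I) * (Real.sin κ * τ.tangent (n + 1) i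
        + Real.cos κ * τ.normal (n + 1) i - Complex.I * τ.binormal (n + 1) i) := fun i => by
    have hB : Complex.I * τ.binormal (n + 1) i = τ.normal (n + 1) i - (τ.nrm (n + 1))⁻¹
      * nullVec (conj (τ.f (n + 1) 0)) (conj (τ.g (n + 1) 0)) (τ.rho (n + 1)) i := by
      linear_combination -hW (n + 1) i
    rw [hW, hB, hN, hT, hf', hg', hρs,
      nullVec_transfer (f := τ.f (n + 1) 0) (g := τ.g (n + 1) 0) hρ, hD, hcC, hsC]
    field_simp
    ring
  rw [Complex.exp_mul_I, ← Complex.ofReal_cos, ← Complex.ofReal_sin] at kW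
  refine ⟨?_, ?_, ?_⟩ <;> ext i
  · have h := kT i
    simp only [PiLp.sub_apply, PiLp.smul_apply, smul_eq_mul]
    exact_mod_cast h
  · have h := congrArg Complex.re (kW i)
    simp [-Complex.ofReal_cos, -Complex.ofReal_sin] at h ⊢
    linarith
  · have h := congrArg Complex.im (kW i)
    simp [-Complex.ofReal_cos, -Complex.ofReal_sin] at h ⊢
    linarith

theorem st_zero (h : ℂ → ℂ) : st h 0 = conj (h 0) := by rw [st, map_zero]

theorem cos_two_mul_arctan (x : ℝ) : Real.cos (2 * Real.arctan x) = (1 - x ^ 2) / (1 + x ^ 2) := by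
  have : 1 + x ^ 2 ≠ 0 := by positivity
  rw [Real.cos_two_mul, Real.cos_sq_arctan]
  field_simp
  ring

theorem sin_two_mul_arctan (x : ℝ) : Real.sin (2 * Real.arctan x) = 2 * x / (1 + x ^ 2) := by
  have h := Real.tan_mul_cos (Real.cos_arctan_pos x).ne'
  rw [Real.tan_arctan] at h
  rw [Real.sin_two_mul, ← h]
  linear_combination 2 * x * Real.cos_sq_arctan x

theorem two_mul_arctan_range (x : ℝ) :
    -Real.pi < 2 * Real.arctan x ∧ 2 * Real.arctan x < Real.pi := by
  constructor <;> linarith [Real.arctan_lt_pi_div_two x, Real.neg_pi_div_two_lt_arctan x]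

theorem toReal_add (a b : Fin 3 → ℂ) : toReal (a + b) = toReal a + toReal b := by
  ext i
  simp [toReal]

/-! ### From the bilinear system to a framed curve -/

section Tau

variable {τ : Tau} {b : ℂ}

theorem IsTau.nrm_eq (hτ : IsTau τ b) (n : ℤ) : τ.nrm n = τ.F (n + 1) 0 * τ.F n 0 := by
  rw [← hτ.i1, st_zero, st_zero, Tau.nrm]

theorem IsTau.ofReal_F (hτ : IsTau τ b) (n : ℤ) : (((τ.F n 0).re : ℝ) : ℂ) = τ.F n 0 :=
  Complex.ext rfl (by simpa using (hτ.real_F n 0).symm)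

theorem IsTau.ofReal_Gt (hτ : IsTau τ b) (n : ℤ) : (((τ.Gt n 0).re : ℝ) : ℂ) = τ.Gt n 0 :=
  Complex.ext rfl (by simpa using (hτ.real_Gt n 0).symm)

theorem IsTau.conj_F (hτ : IsTau τ b) (n : ℤ) : conj (τ.F n 0) = τ.F n 0 := by
  rw [← hτ.ofReal_F, Complex.conj_ofReal]

theorem IsTau.ofReal_const (hτ : IsTau τ b) : ((b.re : ℝ) : ℂ) = b :=
  Complex.ext rfl (by simpa using hτ.real_const.symm)

theorem IsTau.curvature_ratio (hτ : IsTau τ b) (n : ℤ) : τ.Gt n 0 / (b * τ.F n 0)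
    = ((τ.Gt n 0).re / (b.re * (τ.F n 0).re) : ℝ) := by
  push_cast
  rw [hτ.ofReal_Gt, hτ.ofReal_F, hτ.ofReal_const]

/-- Divide by `F_{n+1} F_n`: the equation for `H` and its conjugate give the first two coordinates,
and in the third `1 - 2 g g^* / D_n` equals `(f f^* - g g^*) / D_n`. -/
theorem IsTau.curveC_succ (hτ : IsTau τ b) (hF : ∀ n, τ.F n 0 ≠ 0) (n : ℤ) :
    τ.curveC (n + 1) = τ.curveC n + τ.tangentC n := by
  have h4 := hτ.i4 n 0
  have h5 := hτ.i5 n 0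
  have h1 := hτ.i1 n 0
  rw [st_zero] at h4 h5
  have h4c := congrArg conj h4
  simp only [map_sub, map_mul, hτ.conj_F, Complex.conj_conj] at h4c
  have f0 := hF n
  have f1 := hF (n + 1)
  rw [st_zero, st_zero] at h1
  ext i
  rw [Pi.add_apply, τ.tangentC_eq, hτ.nrm_eq]
  fin_cases i <;>
    simp only [Tau.curveC, tanVec, Fin.zero_eta, Fin.mk_one, Fin.reduceFinMk, Matrix.cons_val_zero,
      Matrix.cons_val_one, Matrix.cons_val, logDeriv_apply, one_div, Complex.inv_I]
  · field_simp
    linear_combination h4 + h4c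
  · field_simp
    linear_combination -(h4 - h4c)
  · push_cast
    field_simp
    linear_combination -2 * h5 - h1

theorem IsTau.isFrenetFramed (hτ : IsTau τ b) (hb : b ≠ 0) (hF : ∀ n, τ.F n 0 ≠ 0) {l : ℝ}
    {κ : ℤ → ℝ} (hl : -Real.pi < l ∧ l < Real.pi ∧ l ≠ 0)
    (hG : ∀ n, τ.G n 0 = 2 * τ.rho n * τ.Gt n 0)
    (hρ : ∀ n, 4 * τ.rho n * conj (τ.rho n) = 1)
    (hρs : ∀ n, τ.rho n = τ.rho (n + 1) * Complex.exp (l * Complex.I))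
    (hκ : ∀ n, κ n = 2 * Real.arctan (τ.Gt n 0 / (b * τ.F n 0)).re) :
    IsFrenetFramed τ.curve τ.tangent τ.normal τ.binormal (fun _ => l) κ := by
  have hT : ∀ n, _ := fun n => by
    have hb' : b.re ≠ 0 := fun h => hb (by rw [← hτ.ofReal_const, h, Complex.ofReal_zero])
    have hF' : ∀ n, (τ.F n 0).re ≠ 0 := fun n h =>
      hF n (by rw [← hτ.ofReal_F, h, Complex.ofReal_zero])
    have f1 := hF' (n + 1)
    have f2 := hF' (n + 1 + 1)
    have f2c := hF (n + 1 + 1)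
    have h2 := hτ.i2 (n + 1) 0
    have h3 := hτ.i3 (n + 1) 0
    rw [st_zero, add_sub_cancel_right, hG] at h2 h3
    -- These quotients are `p` and `q`: dividing the second and third bilinear equations at index `n
    -- + 1` by `F_{n+2}` gives the spinor step, with `q / p = G̃_{n+1} / (b F_{n+1})`.
    have hpos : 0 < (b.re * (τ.F (n + 1) 0).re / (τ.F (n + 1 + 1) 0).re) ^ 2
        + ((τ.Gt (n + 1) 0).re / (τ.F (n + 1 + 1) 0).re) ^ 2 := by positivity
    refine τ.frame_transfer n (κ := κ (n + 1)) hpos (hρ _) (hρs n) ?_ ?_ ?_ ?_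
    · push_cast
      rw [hτ.ofReal_F, hτ.ofReal_F, hτ.ofReal_Gt, hτ.ofReal_const]
      field_simp
      linear_combination -h2
    · push_cast
      rw [hτ.ofReal_F, hτ.ofReal_F, hτ.ofReal_Gt, hτ.ofReal_const]
      field_simp
      linear_combination -h3
    · rw [hκ, hτ.curvature_ratio, Complex.ofReal_re, cos_two_mul_arctan]
      field_simp
    · rw [hκ, hτ.curvature_ratio, Complex.ofReal_re, sin_two_mul_arctan]
      field_simp
  refine isFrenetFramed_of_frenet (fun n => τ.frame_mem_specialOrthogonalGroup n ?_ (hρ n))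
    (fun n => ?_) (fun n => (hT n).1) (fun n => (hT n).2.1) (fun n => (hT n).2.2)
    (fun n => hκ n ▸ two_mul_arctan_range _) hl
  · rw [hτ.nrm_eq]
    exact mul_ne_zero (hF _) (hF _)
  · rw [Tau.curve, hτ.curveC_succ hF, toReal_add]
    rfl

end Tau

/-! ### The theta-function solution -/

section ThetaTau

variable {v r y : ℝ} (C Γ t : ℝ)

/-- `Δ₃ - Δ₁` is imaginary, so for real `z` the argument of `ϑ₂` in `F_n` stays on the imaginary
axis, where `ϑ₂` has no zero. -/
theorem exists_mu_eq_I_mul (v r y : ℝ) (n : ℤ) (x : ℝ) :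
    ∃ w : ℝ, mu v r y n x = Complex.I * w := by
  have h := conj_mu_conj v r y n x
  rw [Complex.conj_ofReal] at h
  have h' := congrArg Complex.re h
  simp only [Complex.conj_re, Complex.neg_re] at h'
  refine ⟨(mu v r y n x).im, Complex.ext ?_ ?_⟩
  · simp
    linarith
  · simp

theorem thetaTau_F_ne_zero (hy : 0 < y) (n : ℤ) (x : ℝ) : (thetaTau v r y C Γ t).F n x ≠ 0 := by
  obtain ⟨w, hw⟩ := exists_mu_eq_I_mul v r y n x
  refine mul_ne_zero (mul_ne_zero (alpha2_ne_zero hy r) (ex_ne_zero _ _ _ _ _ _ _ _ _)) ?_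
  rw [hw, show Complex.I * w - 1 / 2 * Complex.I * v + Complex.I * t
    = Complex.I * (w - 1 / 2 * v + t : ℝ) by push_cast; ring]
  exact th2_I_mul_ne_zero hy _

/-- The ratio `G_n / G̃_n` depends neither on `z` nor on `t`; this is the reason for constant
torsion. -/
theorem thetaTau_G_eq (n : ℤ) (z : ℂ) : (thetaTau v r y C Γ t).G n z
    = Complex.I * (R1 v r y * (R3 v r y)⁻¹) ^ (-n) * (thetaTau v r y C Γ t).Gt n z := by
  simp only [thetaTau, mul_zpow, inv_zpow', neg_neg]
  linear_combination alpha2 r y * (th1 y (Complex.I * v) / th3 y 0) * R1 v r y ^ (-n)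
    * R3 v r y ^ n * ex v r y C Γ t n 0 z
    * th4 y (mu v r y n z - 1 / 2 * Complex.I * v + Complex.I * t) * Complex.I_sq

theorem st_thetaTau_G_eq (hy : 0 < y) (n : ℤ) (z : ℂ) : st ((thetaTau v r y C Γ t).G n) z
    = -Complex.I * (R1 v r y * (R3 v r y)⁻¹) ^ n * (thetaTau v r y C Γ t).Gt n z := by
  rw [st_thetaTau_G C Γ t hy]
  simp only [thetaTau, mul_zpow, inv_zpow']
  linear_combination -alpha2 r y * (th1 y (Complex.I * v) / th3 y 0) * R1 v r y ^ n
    * R3 v r y ^ (-n) * ex v r y C Γ t n 0 z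
    * th4 y (mu v r y n z - 1 / 2 * Complex.I * v + Complex.I * t) * Complex.I_sq

/-- `G̃_n` may vanish at `z = 0`, but it is analytic and not identically zero, so the zero is
isolated and limits along the punctured neighbourhood make sense. -/
theorem thetaTau_Gt_eventually_ne_zero (hy : 0 < y) (hr : ∀ j : ℤ, r ≠ 1 / 2 * (j : ℝ))
    (hv : ∀ j : ℤ, v ≠ y * (j : ℝ)) (n : ℤ) :
    ∀ᶠ z in 𝓝[≠] (0 : ℂ), (thetaTau v r y C Γ t).Gt n z ≠ 0 := by
  have hd : Differentiable ℂ fun z => th4 y (mu v r y n z - 1 / 2 * Complex.I * v + Complex.I * t) := by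
    refine (differentiable_th4 hy).comp ?_
    unfold mu
    fun_prop
  have ha : AnalyticOnNhd ℂ (fun z => th4 y (mu v r y n z - 1 / 2 * Complex.I * v + Complex.I * t))
      Set.univ := fun z _ => hd.analyticAt z
  rcases (ha 0 trivial).eventually_eq_zero_or_eventually_ne_zero with h | h
  · have h0 := ha.eq_of_eventuallyEq (g := fun _ => 0) analyticOnNhd_const h
    have hD := Delta3_sub_Delta1_ne_zero hy hr hv
    -- The point at which the argument of `ϑ₄` is zero, where `ϑ₄(0) ≠ 0` contradicts identical
    -- vanishing.
    have := congrFun h0 (-(Complex.I * v * n - 1 / 2 * Complex.I * v + Complex.I * t)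
      * (Delta3 v r y - Delta1 v r y))
    simp only [mu, mul_div_cancel_right₀ _ hD] at this
    refine absurd ?_ (th4_zero_ne_zero hy)
    convert this using 2
    ring
  · filter_upwards [h] with z hz
    refine mul_ne_zero (mul_ne_zero (mul_ne_zero (mul_ne_zero (neg_ne_zero.mpr Complex.I_ne_zero)
      (alpha2_ne_zero hy r)) (div_ne_zero (th1_I_mul_ne_zero hy hv) (th3_zero_ne_zero hy)))
      (ex_ne_zero _ _ _ _ _ _ _ _ _)) hz

theorem thetaTau_rho (hy : 0 < y) (hr : ∀ j : ℤ, r ≠ 1 / 2 * (j : ℝ))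
    (hv : ∀ j : ℤ, v ≠ y * (j : ℝ)) (n : ℤ) : (thetaTau v r y C Γ t).rho n
      = 1 / 2 * (Complex.I * (R1 v r y * (R3 v r y)⁻¹) ^ (-n)) := by
  refine Tendsto.limUnder_eq (tendsto_const_nhds.congr' ?_)
  filter_upwards [thetaTau_Gt_eventually_ne_zero C Γ t hy hr hv n] with z hz
  rw [thetaTau_G_eq, mul_div_cancel_right₀ _ hz]

theorem thetaTau_torsionExpr (hy : 0 < y) (hr : ∀ j : ℤ, r ≠ 1 / 2 * (j : ℝ))
    (hv : ∀ j : ℤ, v ≠ y * (j : ℝ)) {n : ℤ} {z : ℂ} (h : (thetaTau v r y C Γ t).Gt n z ≠ 0)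
    (h' : (thetaTau v r y C Γ t).Gt (n - 1) z ≠ 0) :
    (thetaTau v r y C Γ t).torsionExpr n z = (lam v r y : ℂ) := by
  rw [ofReal_lam hy hr hv, Tau.torsionExpr, thetaTau_G_eq, st_thetaTau_G_eq C Γ t hy]
  have hw : R1 v r y * (R3 v r y)⁻¹ ≠ 0 :=
    mul_ne_zero (R1_ne_zero hy hv) (inv_ne_zero (R3_ne_zero hy hr))
  generalize R1 v r y * (R3 v r y)⁻¹ = w at *
  congr 2
  have hz : w ^ n * w ^ (-(n - 1)) = w := by
    rw [← zpow_add₀ hw, neg_sub, add_sub_cancel, zpow_one]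
  rw [div_eq_iff (mul_ne_zero h h')]
  linear_combination (thetaTau v r y C Γ t).Gt n z * (thetaTau v r y C Γ t).Gt (n - 1) z
    * (hz - w ^ n * w ^ (-(n - 1)) * Complex.I_sq)

theorem conj_R1_mul_R3_inv (v r y : ℝ) :
    conj (R1 v r y * (R3 v r y)⁻¹) = (R1 v r y * (R3 v r y)⁻¹)⁻¹ := by
  rw [map_mul, map_inv₀, conj_R1, conj_R3, mul_inv]

theorem thetaTau_isFrenetFramed (hy : 0 < y) (hr : ∀ j : ℤ, r ≠ 1 / 2 * (j : ℝ))
    (hv : ∀ j : ℤ, v ≠ y * (j : ℝ)) :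
    IsFrenetFramed (thetaTau v r y C Γ t).curve (thetaTau v r y C Γ t).tangent
      (thetaTau v r y C Γ t).normal (thetaTau v r y C Γ t).binormal
      (fun _ => lam v r y) (kappa v r y C Γ t) := by
  have hw : R1 v r y * (R3 v r y)⁻¹ ≠ 0 :=
    mul_ne_zero (R1_ne_zero hy hv) (inv_ne_zero (R3_ne_zero hy hr))
  have hρ := thetaTau_rho C Γ t hy hr hv
  refine (isTau_thetaTau C Γ t hy hr hv).isFrenetFramed (beta_ne_zero hy v)
    (fun n => by exact_mod_cast thetaTau_F_ne_zero C Γ t hy n 0) (lam_range hy hr hv)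
    (fun n => ?_) (fun n => ?_) (fun n => ?_) (fun n => rfl)
  · rw [hρ, thetaTau_G_eq]
    ring
  · rw [hρ, map_mul, map_mul, map_zpow₀, conj_R1_mul_R3_inv, inv_zpow', neg_neg, Complex.conj_I]
    simp only [map_div₀, map_one, Complex.conj_ofNat]
    have := zpow_neg_mul_zpow_self n hw
    linear_combination (-Complex.I ^ 2) * this - Complex.I_sq
  · rw [hρ, hρ, exp_lam_mul_I hy hr hv, neg_add, ← sub_eq_add_neg, zpow_sub_one₀ hw, mul_assoc, mul_assoc,
      mul_assoc, inv_mul_cancel₀ hw, mul_one]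

theorem curvRatio_eq_thetaRatio (hy : 0 < y) (n : ℤ) :
    curvRatio v r y C Γ t n = thetaRatio v y t n := by
  have h0 := th3_zero_ne_zero hy
  have ha := alpha2_ne_zero hy r
  have he := ex_ne_zero v r y C Γ t n 0 0
  simp only [curvRatio, thetaRatio, thetaTau, beta, mu, zero_div, add_zero]
  have h3 := th3_I_mul_ne_zero hy v
  field_simp

theorem thetaTau_curveC_im (hy : 0 < y) (n : ℤ) (i : Fin 3) :
    ((thetaTau v r y C Γ t).curveC n i).im = 0 := by
  have hF := st_thetaTau_F (v := v) (r := r) C Γ t hy n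
  have hF0 := congrFun hF 0
  rw [st_zero] at hF0
  have hF' : ∀ x, conj ((thetaTau v r y C Γ t).F n x) = (thetaTau v r y C Γ t).F n (conj x) :=
    fun x => by
      nth_rw 2 [← hF]
      rw [st, Complex.conj_conj]
  have hd := conj_deriv_of_conj hF' 0
  rw [map_zero] at hd
  refine Complex.conj_eq_iff_im.mp ?_
  fin_cases i
  · simp [Tau.curveC, hF0, add_comm]
  · simp [Tau.curveC, hF0]
    ring
  · simp [Tau.curveC, logDeriv_apply, hF0, hd, Complex.conj_ofNat]

/-! ### Closed curves -/

theorem mu_add_nat {k : ℕ} {m : ℤ} (h : (k : ℝ) * v = m * y) (n : ℤ) (z : ℂ) :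
    mu v r y (n + k) z = mu v r y n z + Complex.I * y * m := by
  have h' : (k : ℂ) * v = m * y := by exact_mod_cast h
  rw [mu, mu]
  push_cast
  linear_combination Complex.I * h'

/-- The quasi-period factor of `ϑ₂` contains `μ_n`, hence `z`; this adds `-2πim` to `kΔ₃` in the
exponent linear in `z`. -/
theorem thetaTau_F_add_nat {k : ℕ} {m : ℤ} (h : (k : ℝ) * v = m * y) (n : ℤ) (z : ℂ) :
    (thetaTau v r y C Γ t).F (n + k) z
      = Complex.exp (Real.pi * y * m ^ 2 - 2 * Real.pi * Complex.I * m
          * (mu v r y n 0 - 1 / 2 * Complex.I * v + Complex.I * t)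
        + (k * Delta3 v r y - 2 * Real.pi * Complex.I * m) / (Delta3 v r y - Delta1 v r y) * z)
        * (thetaTau v r y C Γ t).F n z := by
  simp only [thetaTau]
  rw [mu_add_nat h, show mu v r y n z + Complex.I * y * m - 1 / 2 * Complex.I * v + Complex.I * t
    = mu v r y n z - 1 / 2 * Complex.I * v + Complex.I * t + Complex.I * y * m by ring,
    th2_add_int_mul_period]
  have e : ex v r y C Γ t ((n + k : ℤ) : ℂ) 0 z * Complex.exp (Real.pi * y * m ^ 2
      - 2 * Real.pi * Complex.I * m * (mu v r y n z - 1 / 2 * Complex.I * v + Complex.I * t))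
      = Complex.exp (Real.pi * y * m ^ 2 - 2 * Real.pi * Complex.I * m
          * (mu v r y n 0 - 1 / 2 * Complex.I * v + Complex.I * t)
        + (k * Delta3 v r y - 2 * Real.pi * Complex.I * m) / (Delta3 v r y - Delta1 v r y) * z)
      * ex v r y C Γ t n 0 z := by
    rw [ex, ex, ← Complex.exp_add, ← Complex.exp_add, mu, mu]
    congr 1
    push_cast
    ring
  linear_combination alpha2 r y * th2 y (mu v r y n z - 1 / 2 * Complex.I * v + Complex.I * t) * e

/-- Compared with `F`, the extra factors are `exp (4πimr)` from the shift `-2r`, `exp (-πim) = exp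
(πim)` from `ϑ₄`, and `(R₁ R₃)^(-k)`. The hypothesis `hΛ` says that their product is one. -/
theorem thetaTau_H_add_nat (hy : 0 < y) (hr : ∀ j : ℤ, r ≠ 1 / 2 * (j : ℝ))
    (hv : ∀ j : ℤ, v ≠ y * (j : ℝ)) {k : ℕ} {m : ℤ} (h : (k : ℝ) * v = m * y)
    (hΛ : Complex.exp (Real.pi * Complex.I * m * (4 * r + 1)) * (R1 v r y * R3 v r y) ^ (-(k : ℤ))
      = 1) (n : ℤ) :
    (thetaTau v r y C Γ t).H (n + k) 0
      = Complex.exp (Real.pi * y * m ^ 2 - 2 * Real.pi * Complex.I * m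
          * (mu v r y n 0 - 1 / 2 * Complex.I * v + Complex.I * t))
        * (thetaTau v r y C Γ t).H n 0 := by
  simp only [thetaTau]
  rw [mu_add_nat h, show mu v r y n 0 + Complex.I * y * m - 1 / 2 * Complex.I * v - 2 * r
      + Complex.I * t
    = mu v r y n 0 - 1 / 2 * Complex.I * v - 2 * r + Complex.I * t + Complex.I * y * m by ring,
    th4_add_int_mul_period, neg_add, zpow_add₀ (R1_ne_zero hy hv), zpow_add₀ (R3_ne_zero hy hr),
    show ex v r y C Γ t ((n + k : ℤ) : ℂ) 1 0 = ex v r y C Γ t n 1 0 by simp [ex]]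
  have e1 : Complex.exp (-(Real.pi * Complex.I * m)) = Complex.exp (Real.pi * Complex.I * m) := by
    rw [Complex.exp_eq_exp_iff_exists_int]
    exact ⟨-m, by push_cast; ring⟩
  have e2 : Complex.exp (Real.pi * y * m ^ 2 - 2 * Real.pi * Complex.I * m
        * (mu v r y n 0 - 1 / 2 * Complex.I * v - 2 * r + Complex.I * t))
      * Complex.exp (Real.pi * Complex.I * m)
      = Complex.exp (Real.pi * Complex.I * m * (4 * r + 1))
        * Complex.exp (Real.pi * y * m ^ 2 - 2 * Real.pi * Complex.I * m
          * (mu v r y n 0 - 1 / 2 * Complex.I * v + Complex.I * t)) := by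
    rw [← Complex.exp_add, ← Complex.exp_add]
    congr 1
    ring
  rw [mul_zpow] at hΛ
  rw [e1, e2]
  generalize u2 v r y / (alpha2 r y * s2 v r y) = q
  linear_combination q * R1 v r y ^ (-n) * R3 v r y ^ (-n) * ex v r y C Γ t n 1 0
    * Complex.exp (Real.pi * y * m ^ 2 - 2 * Real.pi * Complex.I * m
          * (mu v r y n 0 - 1 / 2 * Complex.I * v + Complex.I * t))
    * th4 y (mu v r y n 0 - 1 / 2 * Complex.I * v - 2 * r + Complex.I * t) * hΛ

theorem thetaTau_isClosedWithPeriod (hy : 0 < y) (hr : ∀ j : ℤ, r ≠ 1 / 2 * (j : ℝ))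
    (hv : ∀ j : ℤ, v ≠ y * (j : ℝ)) {k : ℕ} {m : ℤ} (hc : ClosureCondition v r y k m) :
    IsClosedWithPeriod (thetaTau v r y C Γ t).curve k := fun n => by
  obtain ⟨-, h, hΛ, hΞ⟩ := hc
  have hτ := isTau_thetaTau C Γ t hy hr hv
  have hF0 : ∀ n, (thetaTau v r y C Γ t).F n 0 ≠ 0 := fun n => by
    exact_mod_cast thetaTau_F_ne_zero C Γ t hy n 0
  have hD := Delta3_sub_Delta1_ne_zero hy hr hv
  have hF := thetaTau_F_add_nat (r := r) C Γ t h n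
  have hH := thetaTau_H_add_nat C Γ t hy hr hv h (sub_eq_zero.mp hΛ) n
  have hFz := hF 0
  rw [mul_zero, add_zero] at hFz
  have hlog : logDeriv ((thetaTau v r y C Γ t).F (n + k)) 0
      = (k * Delta3 v r y - 2 * Real.pi * Complex.I * m) / (Delta3 v r y - Delta1 v r y)
        + logDeriv ((thetaTau v r y C Γ t).F n) 0 := by
    rw [show (thetaTau v r y C Γ t).F (n + k) = _ from funext hF]
    generalize Real.pi * y * m ^ 2 - 2 * Real.pi * Complex.I * m
          * (mu v r y n 0 - 1 / 2 * Complex.I * v + Complex.I * t) = A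
    generalize (k * Delta3 v r y - 2 * Real.pi * Complex.I * m)
      / (Delta3 v r y - Delta1 v r y) = B
    have hE : HasDerivAt (fun z => Complex.exp (A + B * z)) (Complex.exp (A + B * 0) * (B * 1)) 0 :=
      (((hasDerivAt_id (0 : ℂ)).const_mul B).const_add A).cexp
    rw [logDeriv_mul (f := fun z => Complex.exp (A + B * z)) 0 (Complex.exp_ne_zero _) (hF0 n)
      hE.differentiableAt (hτ.differentiable_F n 0), logDeriv_apply, hE.deriv, mul_one,
      mul_div_cancel_left₀ _ (Complex.exp_ne_zero _)]
  generalize Complex.exp (Real.pi * y * m ^ 2 - 2 * Real.pi * Complex.I * m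
          * (mu v r y n 0 - 1 / 2 * Complex.I * v + Complex.I * t)) = E at *
  have hE0 : E ≠ 0 := fun h => hF0 (n + k) (by rw [hFz, h, zero_mul])
  -- `E` is a quotient of two nonzero real values of `F`, so the conjugate of `H` acquires the same
  -- factor as `H`.
  have hEc : conj E = E := by
    have h1 := hτ.conj_F (n + k)
    rw [hFz, map_mul, hτ.conj_F] at h1
    exact mul_right_cancel₀ (hF0 n) h1
  have hcurve : (thetaTau v r y C Γ t).curveC (n + k) = (thetaTau v r y C Γ t).curveC n := by
    have f0 := hF0 n
    ext i
    fin_cases i <;>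
      simp only [Tau.curveC, Fin.zero_eta, Fin.mk_one, Fin.reduceFinMk, Matrix.cons_val_zero,
        Matrix.cons_val_one, Matrix.cons_val, hFz, hH, hlog, map_mul, hEc]
    · rw [← mul_add, mul_div_mul_left _ _ hE0]
    · rw [← mul_sub, mul_div_mul_left _ _ hE0]
    · rw [div_eq_zero_iff, or_iff_left hD] at hΞ
      -- The index grows by `k` and the logarithmic derivative by the fraction on the right; the
      -- third coordinate is preserved exactly when `(Δ₃ + Δ₁) k = 4πim`.
      have hk : (k : ℂ) = 2 * ((k * Delta3 v r y - 2 * Real.pi * Complex.I * m)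
          / (Delta3 v r y - Delta1 v r y)) := by
        rw [mul_div_assoc', eq_div_iff hD]
        linear_combination -hΞ
      push_cast
      linear_combination hk
  rw [Tau.curve, hcurve]
  rfl

end ThetaTau

end Kaleidocycle

end

/-! ### The framed curve of the theta-function solution -/

open Kaleidocycle in
theorem mainTheorem1 (v r y : ℝ) (hy : 0 < y)
    (hr : ∀ j : ℤ, r ≠ 1 / 2 * (j : ℝ)) (hv : ∀ j : ℤ, v ≠ y * (j : ℝ)) :
    -- all denominators in the construction are nonzero
    (u2 v r y ≠ 0 ∧ s2 v r y ≠ 0 ∧ alpha2 r y ≠ 0 ∧ th3 y 0 ≠ 0 ∧ beta v y ≠ 0 ∧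
      Delta3 v r y - Delta1 v r y ≠ 0) ∧
    -- `(1/i) log (R₁ R₃⁻¹)` is a real number
    ((lam v r y : ℝ) : ℂ) = 1 / Complex.I * Complex.log (R1 v r y * (R3 v r y)⁻¹) ∧
    ∀ C Γ t : ℝ,
      -- τ-functions
      IsTau (thetaTau v r y C Γ t) (beta v y) ∧
      -- the curve and its frame are well defined and real
      (∀ n (x : ℝ), (thetaTau v r y C Γ t).F n x ≠ 0) ∧
      (∀ n i, ((thetaTau v r y C Γ t).tangentC n i).im = 0 ∧
        ((thetaTau v r y C Γ t).normalC n i).im = 0 ∧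
        ((thetaTau v r y C Γ t).binormalC n i).im = 0 ∧
        ((thetaTau v r y C Γ t).curveC n i).im = 0) ∧
      -- unit segment length
      (∀ n, ‖(thetaTau v r y C Γ t).curve (n + 1) - (thetaTau v r y C Γ t).curve n‖ = 1) ∧
      -- torsion angle `lam v r y` for all `n`, signed curvature angle `kappa`
      IsFrenetFramed (thetaTau v r y C Γ t).curve (thetaTau v r y C Γ t).tangent
        (thetaTau v r y C Γ t).normal (thetaTau v r y C Γ t).binormal
        (fun _ => lam v r y) (kappa v r y C Γ t) ∧
      -- the torsion angle in terms of the τ-functions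
      (∀ n, Tendsto ((thetaTau v r y C Γ t).torsionExpr n) (𝓝[≠] 0) (𝓝 (lam v r y : ℂ)) ∧
        ((thetaTau v r y C Γ t).Gt n 0 ≠ 0 → (thetaTau v r y C Γ t).Gt (n - 1) 0 ≠ 0 →
          (thetaTau v r y C Γ t).torsionExpr n 0 = (lam v r y : ℂ))) ∧
      -- the signed curvature angle as a ratio of theta functions
      (∀ n, (curvRatio v r y C Γ t n).im = 0 ∧
        th2 y (Complex.I * v * n - 1 / 2 * Complex.I * v + Complex.I * t) ≠ 0 ∧
        (thetaRatio v y t n).im = 0 ∧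
        kappa v r y C Γ t n = 2 * Real.arctan (thetaRatio v y t n).re) ∧
      -- closedness
      (∀ (k : ℕ) (m : ℤ), ClosureCondition v r y k m →
        IsClosedWithPeriod (thetaTau v r y C Γ t).curve k) := by 
  refine ⟨⟨u2_ne_zero hy hr hv, s2_ne_zero hy hv, alpha2_ne_zero hy r, th3_zero_ne_zero hy,
    beta_ne_zero hy v, Delta3_sub_Delta1_ne_zero hy hr hv⟩, ofReal_lam hy hr hv, fun C Γ t => ?_⟩
  have hτ := isTau_thetaTau C Γ t hy hr hv
  have hfr := thetaTau_isFrenetFramed C Γ t hy hr hv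
  refine ⟨hτ, thetaTau_F_ne_zero C Γ t hy, fun n i => ⟨?_, ?_, ?_, thetaTau_curveC_im C Γ t hy n i⟩,
    fun n => ?_, hfr, fun n => ⟨?_, fun h h' => thetaTau_torsionExpr C Γ t hy hr hv h h'⟩,
    fun n => ?_, fun k m hc => thetaTau_isClosedWithPeriod C Γ t hy hr hv hc⟩
  · exact Complex.conj_eq_iff_im.mp (Tau.conj_tangentC _ n i)
  · exact Complex.conj_eq_iff_im.mp (Tau.conj_normalC _ n i)
  · exact Complex.conj_eq_iff_im.mp (Tau.conj_binormalC _ n i)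
  · have h1 := (frame_relations (hfr.special_orthogonal n)).1
    rw [hfr.curve_succ, add_sub_cancel_left]
    rwa [real_inner_self_eq_norm_sq, pow_eq_one_iff_of_nonneg (norm_nonneg _) two_ne_zero] at h1
  · refine tendsto_const_nhds.congr' ?_
    filter_upwards [thetaTau_Gt_eventually_ne_zero C Γ t hy hr hv n,
      thetaTau_Gt_eventually_ne_zero C Γ t hy hr hv (n - 1)] with z hz hz'
    exact (thetaTau_torsionExpr C Γ t hy hr hv hz hz').symm
  · have him : (curvRatio v r y C Γ t n).im = 0 := by
      rw [curvRatio, hτ.curvature_ratio, Complex.ofReal_im]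
    have he := curvRatio_eq_thetaRatio (r := r) (v := v) C Γ t hy n
    refine ⟨him, ?_, he ▸ him, by rw [kappa, he]⟩
    rw [show Complex.I * v * n - 1 / 2 * Complex.I * v + Complex.I * t
      = Complex.I * (v * n - 1 / 2 * v + t : ℝ) by push_cast; ring]
    exact th2_I_mul_ne_zero hy _
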